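/- **Thick $\mathcal O$-algebra Perturbation Lemma.** Let $\Bbbk$ be a commutative ring. Chain complexes are unbounded complexes of $\Bbbk$-modules with differential of degree $-1$; the Koszul sign rule is used throughout. *Thick maps.* A thick map $\mathbf f\colon A\to B$ of degree $k$ between chain complexes is a sequence of maps $f_n\colon A^{\otimes n}\to B^{\otimes n}$, $n\ge 0$, of degree $k$. Sums and composites are formed levelwise, and $\partial(\mathbf f)_n=d_{B^{\otimes n}}f_n-(-1)^k f_n d_{A^{\otimes n}}$. It is *symmetric* if every $f_n$ is $\Sigma_n$-equivariant. A thick map $\mathbf f$ of degree $0$ is a *morphism* if $f_n=f_1^{\otimes n}$ for all $n$. A thick map $\mathbf t\colon A\to A$ is a *derivation* if $t_n=\sum_{i+1+j=n}1^{\otimes i}\otimes t_1\otimes 1^{\otimes j}$ for all $n$. A thick map $\mathbf h\colon A\to A$ of degree $1$ is a *pseudo-derivation* if, for all $p,q\ge 0$, $$(h_p\otimes 1-1\otimes h_q)h_{p+q}=-h_{p+q}(h_p\otimes 1-1\otimes h_q)=h_p\otimes h_q .$$ *Thick contractions.* A thick contraction from $A$ to $B$ consists of thick maps $\mathbf f\colon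 A\to B$, $\mathbf g\colon B\to A$ of degree $0$ and $\mathbf h\colon A\to A$ of degree $1$ with $\partial(\mathbf f)=0$, $\partial(\mathbf g)=0$, $\partial(\mathbf h)=\mathbf g\mathbf f-\mathbf 1$, $\mathbf f\mathbf g=\mathbf 1$, $\mathbf f\mathbf h=0$, $\mathbf h\mathbf h=0$, $\mathbf h\mathbf g=0$. *$\mathcal O$-algebras.* Let $\mathcal O$ be a (symmetric, unital) operad in chain complexes over $\Bbbk$, and let $\mathcal O[A]=\bigoplus_{n\ge0}\mathcal O(n)\otimes_{\Sigma_n}A^{\otimes n}$. An $\mathcal O$-algebra is a chain complex $A$ with a morphism of chain complexes $\gamma_A\colon\mathcal O[A]\to A$ satisfying the unit and associativity constraints. A thick map of $\mathcal O$-algebras $\mathbf f\colon A\to B$ is a symmetric thick map such that $\gamma_B\circ\mathcal O[\mathbf f]=f_1\circ\gamma_A$, where $\mathcal O[\mathbf f]=\bigoplus_n 1\otimes_{\Sigma_n}f_n$. A *thick contraction of $\mathcal O$-algebras* is a thick contraction $(\mathbf f,\mathbf g,\mathbf h)$ from $A$ to $B$ in which $A$ and $B$ are $\mathcal O$-algebras,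 $\mathbf f$ and $\mathbf g$ are morphisms, $\mathbf h$ is a pseudo-derivation, and $\mathbf f,\mathbf g,\mathbf h$ are thick maps of $\mathcal O$-algebras. *Perturbations.* A perturbation of a chain complex $A$ is a map $t\colon A\to A$ of degree $-1$ with $\partial(t)+t^2=0$; then $A^t$ denotes $A$ with the differential $d_A+t$. A thick perturbation of $A$ is a thick map $\mathbf t\colon A\to A$ of degree $-1$ with $\partial(\mathbf t)+\mathbf t^2=0$. **Theorem.** Let $(\mathbf f,\mathbf g,\mathbf h)$ be a thick contraction of $\mathcal O$-algebras from $A$ to $B$. Let $\mathbf t$ be a thick perturbation of $A$ that is a derivation and a thick map of $\mathcal O$-algebras, and assume that $\mathbf 1-\mathbf h\mathbf t$ is invertible. Put $\mathbf\Sigma=\mathbf t(\mathbf 1-\mathbf h\mathbf t)^{-1}$ and $$\mathbf f'=\mathbf f+\mathbf f\mathbf\Sigma\mathbf h,\qquad \mathbf g'=\mathbf g+\mathbf h\mathbf\Sigma\mathbf g,\qquad \mathbf h'=\mathbf h+\mathbf h\mathbf\Sigma\mathbf h,\qquad \mathbf t'=\mathbf f\mathbf\Sigma\mathbf g .$$ Then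 $t=t_1$ is a perturbation of $A$, $t'=t'_1$ is a perturbation of $B$, and $(\mathbf f',\mathbf g',\mathbf h')$ is a thick contraction of $\mathcal O$-algebras from $A^t$ to $B^{t'}$, where $A^t$ and $B^{t'}$ carry the same $\mathcal O$-algebra structure maps $\gamma_A$ and $\gamma_B$ as $A$ and $B$. -/

import Mathlib

open scoped TensorProduct DirectSum

noncomputable section

namespace ThickHPT

universe u v w z s

/-! ## Graded modules and chain complexes -/

/-- A `ℤ`-graded `R`-module: a module that is the internal direct sum of its homogeneous
components `gr i`, `i : ℤ`. -/
structure GrMod (R : Type u) [CommRing R] : Type (max u (v + 1)) where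
  carrier : Type v
  [addCommGroup : AddCommGroup carrier]
  [module : Module R carrier]
  gr : ℤ → Submodule R carrier
  isInternal : DirectSum.IsInternal gr

attribute [instance] GrMod.addCommGroup GrMod.module

instance {R : Type u} [CommRing R] : CoeSort (GrMod.{u, v} R) (Type v) := ⟨GrMod.carrier⟩

/-- An unbounded chain complex of `R`-modules, with differential of degree `-1`. -/
structure ChainCx (R : Type u) [CommRing R] : Type (max u (v + 1)) extends GrMod.{u, v} R where
  d : carrier →ₗ[R] carrier
  d_mem : ∀ (i : ℤ) (x : carrier), x ∈ gr i → d x ∈ gr (i - 1)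
  d_d : ∀ x : carrier, d (d x) = 0

instance {R : Type u} [CommRing R] : CoeSort (ChainCx.{u, v} R) (Type v) :=
  ⟨fun A => A.toGrMod.carrier⟩

section

variable {R : Type u} [CommRing R]

/-- The sign `(-1) ^ n` as an element of `R`. -/
def sg (R : Type u) [CommRing R] (n : ℤ) : R := ((n.negOnePow : ℤ) : R)

theorem sg_zero : sg R 0 = 1 := by simp [sg]

theorem sg_add (m n : ℤ) : sg R (m + n) = sg R m * sg R n := by
  simp [sg, Int.negOnePow_add]

theorem sg_congr {m n : ℤ} (h : Even (m - n)) : sg R m = sg R n := by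
  rw [sg, sg, (Int.negOnePow_eq_iff m n).mpr h]

/-- The endomorphism of a graded module that multiplies the component of degree `i` by `c i`. -/
def GrMod.weight (A : GrMod.{u, v} R) (c : ℤ → R) : A →ₗ[R] A :=
  (DirectSum.toModule R ℤ A fun i => c i • (A.gr i).subtype) ∘ₗ
    (LinearEquiv.ofBijective (DirectSum.coeLinearMap A.gr) A.isInternal).symm.toLinearMap

/-- On homogeneous elements, `weight c` is multiplication by `c i`. -/
theorem GrMod.weight_apply (A : GrMod.{u, v} R) (c : ℤ → R) {i : ℤ} {x : A} (hx : x ∈ A.gr i) :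
    A.weight c x = c i • x := by
  have h : (LinearEquiv.ofBijective (DirectSum.coeLinearMap A.gr) A.isInternal).symm x =
      DirectSum.lof R ℤ (fun i => A.gr i) i ⟨x, hx⟩ := by
    rw [LinearEquiv.symm_apply_eq]
    exact (DirectSum.coeLinearMap_lof A.gr i ⟨x, hx⟩).symm
  simp only [GrMod.weight, LinearMap.comp_apply, LinearEquiv.coe_coe]
  rw [h, DirectSum.toModule_lof]
  simp

/-- The Koszul sign operator `a ↦ (-1) ^ (k * |a|) a`. -/
def GrMod.sgn (A : GrMod.{u, v} R) (k : ℤ) : A →ₗ[R] A :=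
  A.weight fun i => sg R (k * i)

/-- The projection of a graded module onto its even part (`e = 0`) or its odd part (`e = 1`). -/
def GrMod.parityProj (A : GrMod.{u, v} R) (e : Fin 2) : A →ₗ[R] A :=
  A.weight fun i => if i % 2 = (e : ℕ) then 1 else 0

theorem GrMod.sgn_apply (A : GrMod.{u, v} R) (k : ℤ) {i : ℤ} {x : A} (hx : x ∈ A.gr i) :
    A.sgn k x = sg R (k * i) • x :=
  A.weight_apply _ hx

/-- The homogeneous components span. -/
theorem GrMod.iSup_gr (A : GrMod.{u, v} R) : ⨆ i, A.gr i = ⊤ :=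
  A.isInternal.submodule_iSup_eq_top

/-- Linear maps that agree on homogeneous elements are equal. -/
theorem GrMod.hom_ext (A : GrMod.{u, v} R) {M : Type*} [AddCommGroup M] [Module R M]
    {f g : A →ₗ[R] M} (h : ∀ (i : ℤ) (x : A), x ∈ A.gr i → f x = g x) : f = g := by
  have : (⊤ : Submodule R A) ≤ LinearMap.eqLocus f g := by
    rw [← A.iSup_gr]
    exact iSup_le fun i x hx => h i x hx
  ext x
  exact this (Submodule.mem_top (x := x))

/-! ## Tensor powers -/

/-- The underlying module of `A^{⊗ n}`. -/
abbrev TPow (A : GrMod.{u, v} R) (n : ℕ) : Type (max u v) := ⨂[R]^n A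

/-- The component of degree `m` of `A^{⊗ n}`: it is spanned by the pure tensors
`a_1 ⊗ ⋯ ⊗ a_n` of homogeneous elements with `|a_1| + ⋯ + |a_n| = m`. -/
def tgr (A : GrMod.{u, v} R) (n : ℕ) (m : ℤ) : Submodule R (TPow A n) :=
  Submodule.span R {x | ∃ (δ : Fin n → ℤ) (a : Fin n → A),
    (∀ i, a i ∈ A.gr (δ i)) ∧ ∑ i, δ i = m ∧ x = PiTensorProduct.tprod R a}

/-- The sign operator `x ↦ (-1) ^ (k * |x|) x` on `A^{⊗ n}`. -/
def tsgn (A : GrMod.{u, v} R) (k : ℤ) (n : ℕ) : TPow A n →ₗ[R] TPow A n :=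
  PiTensorProduct.map fun _ => A.sgn k

/-- For `t : A → A` of degree `k`, the map `∑_{i+1+j=n} 1^{⊗ i} ⊗ t ⊗ 1^{⊗ j}` on `A^{⊗ n}`,
with the Koszul sign `(-1) ^ (k (|a_1| + ⋯ + |a_i|))` for moving `t` past the first factors. -/
def derivExt (A : GrMod.{u, v} R) (k : ℤ) (t : A →ₗ[R] A) (n : ℕ) : TPow A n →ₗ[R] TPow A n :=
  ∑ i : Fin n, PiTensorProduct.map fun j =>
    if j < i then A.sgn k else if j = i then t else LinearMap.id

/-- The tensor product differential on `A^{⊗ n}`. -/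
def tdiff (A : ChainCx.{u, v} R) (n : ℕ) : TPow A.toGrMod n →ₗ[R] TPow A.toGrMod n :=
  derivExt A.toGrMod (-1) A.d n

/-- The exponent of the Koszul sign of the permutation that moves the `i`-th of `n` homogeneous
elements, of degrees `δ 0, …, δ (n - 1)`, to position `σ i`. -/
def koszulExp {n : ℕ} (σ : Equiv.Perm (Fin n)) (δ : Fin n → ℤ) : ℤ :=
  ∑ i, ∑ j, if i < j ∧ σ j < σ i then δ i * δ j else 0

/-- The (left) action of `σ` on `A^{⊗ n}` by permuting the tensor factors, with Koszul signs;
the `i`-th factor moves to position `σ i`. See `permTensor_tprod`. -/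
def permTensor (A : GrMod.{u, v} R) {n : ℕ} (σ : Equiv.Perm (Fin n)) :
    TPow A n →ₗ[R] TPow A n :=
  ∑ p : Fin n → Fin 2, sg R (koszulExp σ fun i => ((p i : ℕ) : ℤ)) •
    ((PiTensorProduct.reindex R (fun _ : Fin n => (A : Type v)) σ).toLinearMap ∘ₗ
      PiTensorProduct.map fun i => A.parityProj (p i))

theorem koszulExp_congr {n : ℕ} (σ : Equiv.Perm (Fin n)) {δ δ' : Fin n → ℤ}
    (h : ∀ i, δ i % 2 = δ' i % 2) : sg R (koszulExp σ δ) = sg R (koszulExp σ δ') := by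
  refine sg_congr ?_
  rw [koszulExp, koszulExp, ← Finset.sum_sub_distrib]
  refine Finset.even_sum _ fun i _ => ?_
  rw [← Finset.sum_sub_distrib]
  refine Finset.even_sum _ fun j _ => ?_
  split_ifs
  · rw [Int.even_iff, Int.sub_emod, Int.mul_emod, h i, h j, ← Int.mul_emod]; simp
  · simp

/-- The action of a permutation on pure tensors of homogeneous elements. -/
theorem permTensor_tprod (A : GrMod.{u, v} R) {n : ℕ} (σ : Equiv.Perm (Fin n)) {δ : Fin n → ℤ}
    {a : Fin n → A} (ha : ∀ i, a i ∈ A.gr (δ i)) :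
    permTensor A σ (PiTensorProduct.tprod R a) =
      sg R (koszulExp σ δ) • PiTensorProduct.tprod R fun i => a (σ.symm i) := by
  classical
  let p₀ : Fin n → Fin 2 := fun i => ⟨(δ i % 2).toNat, by omega⟩
  have hp₀ : ∀ i, ((p₀ i : ℕ) : ℤ) = δ i % 2 := fun i => by
    simp only [p₀]; omega
  simp only [permTensor, LinearMap.sum_apply, LinearMap.smul_apply, LinearMap.comp_apply,
    LinearEquiv.coe_coe, PiTensorProduct.map_tprod, PiTensorProduct.reindex_tprod]
  rw [Finset.sum_eq_single p₀]
  · rw [koszulExp_congr (R := R) σ (δ := fun i => ((p₀ i : ℕ) : ℤ)) (δ' := δ)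
      fun i => by rw [hp₀]; omega]
    congr 2
    funext i
    rw [GrMod.parityProj, A.weight_apply _ (ha _), hp₀]
    simp
  · intro p _ hp
    obtain ⟨i, hi⟩ := Function.ne_iff.mp hp
    have h0 : A.parityProj (p i) (a i) = 0 := by
      rw [GrMod.parityProj, A.weight_apply _ (ha _), if_neg, zero_smul]
      intro h
      apply hi
      apply Fin.ext
      have := hp₀ i
      omega
    rw [MultilinearMap.map_coord_zero (PiTensorProduct.tprod R) (σ i) (by simpa using h0),
      smul_zero]
  · simp

/-- Linear maps on `A^{⊗ n}` that agree on pure tensors of homogeneous elements are equal. -/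
theorem tpow_hom_ext (A : GrMod.{u, v} R) {n : ℕ} {M : Type*} [AddCommGroup M] [Module R M]
    {f g : TPow A n →ₗ[R] M}
    (h : ∀ (δ : Fin n → ℤ) (a : Fin n → A), (∀ i, a i ∈ A.gr (δ i)) →
      f (PiTensorProduct.tprod R a) = g (PiTensorProduct.tprod R a)) : f = g := by
  classical
  have key : ∀ (s : Finset (Fin n)) (a : Fin n → A), (∀ i, i ∉ s → ∃ k, a i ∈ A.gr k) →
      f (PiTensorProduct.tprod R a) = g (PiTensorProduct.tprod R a) := by
    intro s
    induction s using Finset.induction_on with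
    | empty =>
      intro a ha
      choose δ hδ using fun i => ha i (Finset.notMem_empty i)
      exact h δ a hδ
    | insert i s hi ih =>
      intro a ha
      have hl : f ∘ₗ (PiTensorProduct.tprod R).toLinearMap a i =
          g ∘ₗ (PiTensorProduct.tprod R).toLinearMap a i := by
        refine A.hom_ext fun k x hx => ?_
        simp only [LinearMap.comp_apply, MultilinearMap.toLinearMap_apply]
        refine ih _ fun j hj => ?_
        by_cases hji : j = i
        · subst hji; exact ⟨k, by simpa using hx⟩
        · rw [Function.update_of_ne hji]
          exact ha j (by simp [hji, hj])
      simpa using LinearMap.congr_fun hl (a i)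
  refine PiTensorProduct.ext ?_
  ext a
  exact key Finset.univ a (by simp)

theorem derivExt_tprod (A : GrMod.{u, v} R) (k : ℤ) (t : A →ₗ[R] A) {n : ℕ} {δ : Fin n → ℤ}
    {a : Fin n → A} (ha : ∀ i, a i ∈ A.gr (δ i)) :
    derivExt A k t n (PiTensorProduct.tprod R a) =
      ∑ i, sg R (k * ∑ j, if j < i then δ j else 0) •
        PiTensorProduct.tprod R (Function.update a i (t (a i))) := by
  simp only [derivExt, LinearMap.sum_apply, PiTensorProduct.map_tprod]
  refine Finset.sum_congr rfl fun i _ => ?_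
  have h1 : (fun j => (if j < i then A.sgn k else if j = i then t else LinearMap.id) (a j)) =
      fun j => sg R (if j < i then k * δ j else 0) • Function.update a i (t (a i)) j := by
    funext j
    by_cases hj : j < i
    · simp only [hj, if_true]
      rw [Function.update_of_ne hj.ne, A.sgn_apply k (ha j)]
    · by_cases hji : j = i
      · subst hji; simp [sg_zero]
      · simp [hj, hji, sg_zero]
  rw [h1, MultilinearMap.map_smul_univ]
  have h2 : ∀ s : Finset (Fin n), (∏ j ∈ s, sg R (if j < i then k * δ j else 0)) =
      sg R (k * ∑ j ∈ s, if j < i then δ j else 0) := by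
    classical
    intro s
    induction s using Finset.induction_on with
    | empty => simp [sg_zero]
    | insert j s hj ih =>
      rw [Finset.prod_insert hj, Finset.sum_insert hj, ih, mul_add, sg_add]
      congr 2
      split_ifs <;> simp
  rw [h2]

theorem koszulExp_update {n : ℕ} (σ : Equiv.Perm (Fin n)) (δ : Fin n → ℤ) (i : Fin n) (k : ℤ) :
    sg R (koszulExp σ (Function.update δ i (δ i + k))) *
        sg R (k * ∑ j, if j < i then δ j else 0) =
      sg R (koszulExp σ δ) * sg R (k * ∑ j, if σ j < σ i then δ j else 0) := by
  have hu : ∀ x, Function.update δ i (δ i + k) x = δ x + if x = i then k else 0 := by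
    intro x
    by_cases h : x = i
    · subst h; simp
    · simp [h]
  have hE : (∑ x, ∑ y, if x < y ∧ σ y < σ x then
        Function.update δ i (δ i + k) x * Function.update δ i (δ i + k) y else 0) =
      (∑ x, ∑ y, if x < y ∧ σ y < σ x then δ x * δ y else 0) +
        ((∑ y, if i < y ∧ σ y < σ i then k * δ y else 0) +
          ∑ x, if x < i ∧ σ i < σ x then k * δ x else 0) := by
    have hs : ∀ x y, (if x < y ∧ σ y < σ x then
        Function.update δ i (δ i + k) x * Function.update δ i (δ i + k) y else 0) =
        (if x < y ∧ σ y < σ x then δ x * δ y else 0) +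
        ((if x = i then (if i < y ∧ σ y < σ i then k * δ y else 0) else 0) +
          if y = i then (if x < i ∧ σ i < σ x then k * δ x else 0) else 0) := by
      intro x y
      rw [hu, hu]
      by_cases hx : x = i
      · subst hx
        by_cases hy : y = x
        · subst hy; simp
        · simp only [hy, if_true, if_false]; split_ifs <;> ring
      · by_cases hy : y = i
        · subst hy
          simp only [hx, if_true, if_false]; split_ifs <;> ring
        · simp [hx, hy]
    simp only [hs, Finset.sum_add_distrib]
    congr 2
    · rw [Finset.sum_comm]; simp
    · simp
  rw [koszulExp, koszulExp, hE, ← sg_add, ← sg_add]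
  refine sg_congr ?_
  simp only [Finset.mul_sum]
  have : ∀ a b c e : ℤ, a + b + c - (a + e) = b + c - e := fun a b c e => by ring
  rw [this, ← Finset.sum_add_distrib, ← Finset.sum_add_distrib, ← Finset.sum_sub_distrib]
  refine Finset.even_sum _ fun j _ => ?_
  rcases lt_trichotomy j i with h | h | h
  · have hne : σ j ≠ σ i := fun e => h.ne (σ.injective e)
    rcases lt_or_gt_of_ne hne with h' | h'
    · simp [h, h', h.not_gt, h'.not_gt]
    · simp only [h, h', h.not_gt, h'.not_gt, true_and, false_and, if_true, if_false]
      exact ⟨k * δ j, by ring⟩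
  · subst h; simp
  · have hne : σ j ≠ σ i := fun e => h.ne' (σ.injective e)
    rcases lt_or_gt_of_ne hne with h' | h'
    · simp [h, h', h.not_gt]
    · simp [h, h', h.not_gt, h'.not_gt]

/-- `∑ 1^{⊗ i} ⊗ t ⊗ 1^{⊗ j}` is equivariant. -/
theorem derivExt_permTensor (A : GrMod.{u, v} R) (k : ℤ) (t : A →ₗ[R] A)
    (ht : ∀ (i : ℤ) (x : A), x ∈ A.gr i → t x ∈ A.gr (i + k)) {n : ℕ}
    (σ : Equiv.Perm (Fin n)) :
    derivExt A k t n ∘ₗ permTensor A σ = permTensor A σ ∘ₗ derivExt A k t n := by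
  refine tpow_hom_ext A fun δ a ha => ?_
  simp only [LinearMap.comp_apply]
  rw [permTensor_tprod A σ ha, map_smul, derivExt_tprod A k t ha,
    derivExt_tprod A k t (δ := fun i => δ (σ.symm i)) (fun i => ha _), map_sum, Finset.smul_sum,
    ← Equiv.sum_comp σ]
  refine Finset.sum_congr rfl fun i _ => ?_
  have ha' : ∀ j, Function.update a i (t (a i)) j ∈
      A.gr (Function.update δ i (δ i + k) j) := by
    intro j
    by_cases h : j = i
    · subst h; simpa using ht _ _ (ha j)
    · simpa [h] using ha j
  rw [map_smul, permTensor_tprod A σ ha', smul_smul, smul_smul]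
  have hs : (∑ j, if j < σ i then δ (σ.symm j) else 0) = ∑ j, if σ j < σ i then δ j else 0 := by
    rw [← Equiv.sum_comp σ]; simp
  rw [hs, ← koszulExp_update, mul_comm]
  congr 2
  funext j
  by_cases h : j = σ i
  · subst h; simp
  · have h' : σ.symm j ≠ i := fun e => h (by simp [← e])
    rw [Function.update_of_ne h, Function.update_of_ne h']

/-! ## Thick maps -/

/-- A family of linear maps `f n : A^{⊗ n} → B^{⊗ n}`, `n ≥ 0`. A thick map of degree `k` is such a
family that satisfies `IsThick k`. Addition and scalar multiplication are levelwise. -/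
abbrev ThickFam (A : GrMod.{u, v} R) (B : GrMod.{u, w} R) : Type (max u v w) :=
  ∀ n : ℕ, TPow A n →ₗ[R] TPow B n

variable {A : GrMod.{u, v} R} {B : GrMod.{u, w} R} {C : GrMod.{u, z} R}

/-- `f` is a thick map of degree `k`: every `f n` is homogeneous of degree `k`. -/
def IsThick (k : ℤ) (f : ThickFam A B) : Prop :=
  ∀ (n : ℕ) (m : ℤ) (x : TPow A n), x ∈ tgr A n m → f n x ∈ tgr B n (m + k)

/-- The identity thick map. -/
def ThickFam.id (A : GrMod.{u, v} R) : ThickFam A A := fun _ => LinearMap.id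

/-- Composition of thick maps. -/
def ThickFam.comp (g : ThickFam B C) (f : ThickFam A B) : ThickFam A C := fun n => g n ∘ₗ f n

/-- The first level of a thick map, as a map `A → B`. -/
def ThickFam.level1 (f : ThickFam A B) : A →ₗ[R] B :=
  (PiTensorProduct.subsingletonEquiv (R := R) (s := fun _ : Fin 1 => (B : Type w)) 0).toLinearMap ∘ₗ
    f 1 ∘ₗ
    (PiTensorProduct.subsingletonEquiv (R := R)
      (s := fun _ : Fin 1 => (A : Type v)) 0).symm.toLinearMap

/-- The differential `∂(f)_n = d f_n - (-1) ^ k f_n d` of a thick map `f` of degree `k`. -/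
def ThickFam.bdry (A : ChainCx.{u, v} R) (B : ChainCx.{u, w} R) (k : ℤ)
    (f : ThickFam A.toGrMod B.toGrMod) : ThickFam A.toGrMod B.toGrMod :=
  fun n => tdiff B n ∘ₗ f n - sg R k • (f n ∘ₗ tdiff A n)

/-- Symmetric thick maps: every level is equivariant for the symmetric group. -/
def IsSymmetric (f : ThickFam A B) : Prop :=
  ∀ (n : ℕ) (σ : Equiv.Perm (Fin n)), f n ∘ₗ permTensor A σ = permTensor B σ ∘ₗ f n

/-- Morphisms: `f_n = f_1^{⊗ n}` for all `n` (for thick maps of degree `0`). -/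
def IsMorphism (f : ThickFam A B) : Prop :=
  ∀ n : ℕ, f n = PiTensorProduct.map fun _ => f.level1

/-- Derivations of degree `k`: `t_n = ∑_{i+1+j=n} 1^{⊗ i} ⊗ t_1 ⊗ 1^{⊗ j}` for all `n`. -/
def IsDerivation (k : ℤ) (t : ThickFam A A) : Prop :=
  ∀ n : ℕ, t n = derivExt A k t.level1 n

/-- The map `f_p ⊗ g_q` on `A^{⊗ p} ⊗ A^{⊗ q}` for `g_q` of degree `k`:
`x ⊗ y ↦ (-1) ^ (k * |x|) f_p x ⊗ g_q y`. -/
def ktensor {p q : ℕ} (k : ℤ) (fp : TPow A p →ₗ[R] TPow A p) (gq : TPow A q →ₗ[R] TPow A q) :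
    TPow A p ⊗[R] TPow A q →ₗ[R] TPow A p ⊗[R] TPow A q :=
  TensorProduct.map (fp ∘ₗ tsgn A k p) gq

/-- The bi-indexed sequence `m^*(f)`: the map `f_{p+q}` transported along the canonical
isomorphism `A^{⊗ p} ⊗ A^{⊗ q} ≃ A^{⊗ (p+q)}`. -/
def mstar (f : ThickFam A A) (p q : ℕ) :
    TPow A p ⊗[R] TPow A q →ₗ[R] TPow A p ⊗[R] TPow A q :=
  TensorPower.mulEquiv.symm.toLinearMap ∘ₗ f (p + q) ∘ₗ TensorPower.mulEquiv.toLinearMap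

/-- Pseudo-derivations (of degree `1`): for all `p, q ≥ 0`,
`(h_p ⊗ 1 - 1 ⊗ h_q) h_{p+q} = - h_{p+q} (h_p ⊗ 1 - 1 ⊗ h_q) = h_p ⊗ h_q`. -/
def IsPseudoDerivation (h : ThickFam A A) : Prop :=
  ∀ p q : ℕ,
    (ktensor 0 (h p) LinearMap.id - ktensor 1 LinearMap.id (h q)) ∘ₗ mstar h p q =
        ktensor 1 (h p) (h q) ∧
      -(mstar h p q ∘ₗ (ktensor 0 (h p) LinearMap.id - ktensor 1 LinearMap.id (h q))) =
        ktensor 1 (h p) (h q)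

/-- A thick contraction: a contraction in the dg-category of thick maps. -/
structure IsThickContraction (A : ChainCx.{u, v} R) (B : ChainCx.{u, w} R)
    (f : ThickFam A.toGrMod B.toGrMod) (g : ThickFam B.toGrMod A.toGrMod)
    (h : ThickFam A.toGrMod A.toGrMod) : Prop where
  deg_f : IsThick 0 f
  deg_g : IsThick 0 g
  deg_h : IsThick 1 h
  bdry_f : ThickFam.bdry A B 0 f = 0
  bdry_g : ThickFam.bdry B A 0 g = 0
  bdry_h : ThickFam.bdry A A 1 h = g.comp f - ThickFam.id A.toGrMod
  f_g : f.comp g = ThickFam.id B.toGrMod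
  f_h : f.comp h = 0
  h_h : h.comp h = 0
  h_g : h.comp g = 0

/-! ## Perturbations -/

/-- A perturbation of a chain complex: a map `t` of degree `-1` with `∂(t) + t² = 0`, where
`∂(t) = d t + t d`. -/
structure IsPerturbation (A : ChainCx.{u, v} R) (t : A →ₗ[R] A) : Prop where
  deg : ∀ (i : ℤ) (x : A), x ∈ A.gr i → t x ∈ A.gr (i - 1)
  eq : A.d ∘ₗ t + t ∘ₗ A.d + t ∘ₗ t = 0

/-- The perturbed chain complex `A^t`: the same graded module with differential `d + t`. -/
@[reducible] def ChainCx.perturb (A : ChainCx.{u, v} R) (t : A →ₗ[R] A) (ht : IsPerturbation A t) :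
    ChainCx.{u, v} R where
  toGrMod := A.toGrMod
  d := A.d + t
  d_mem i x hx := Submodule.add_mem _ (A.d_mem i x hx) (ht.deg i x hx)
  d_d x := by
    have h := LinearMap.congr_fun ht.eq x
    simp only [LinearMap.add_apply, LinearMap.comp_apply, LinearMap.zero_apply] at h
    simp only [LinearMap.add_apply, map_add, A.d_d, zero_add]
    rw [← h]
    abel

/-- A thick perturbation of `A`: a thick map `t` of degree `-1` with `∂(t) + t² = 0`. -/
structure IsThickPerturbation (A : ChainCx.{u, v} R) (t : ThickFam A.toGrMod A.toGrMod) :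
    Prop where
  deg : IsThick (-1) t
  eq : ThickFam.bdry A A (-1) t + t.comp t = 0

/-! ## Symmetric sequences and Schur functors -/

/-- A symmetric sequence: chain complexes `obj n` with a right action of the symmetric group on
`n` letters by chain maps, `act σ μ = μ · σ`. -/
structure SymSeq (R : Type u) [CommRing R] : Type (max u (s + 1)) where
  obj : ℕ → ChainCx.{u, s} R
  act : ∀ {n : ℕ}, Equiv.Perm (Fin n) → (obj n →ₗ[R] obj n)
  act_one : ∀ {n : ℕ} (μ : obj n), act 1 μ = μ
  act_mul : ∀ {n : ℕ} (σ τ : Equiv.Perm (Fin n)) (μ : obj n), act (σ * τ) μ = act τ (act σ μ)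
  act_mem : ∀ {n : ℕ} (σ : Equiv.Perm (Fin n)) (i : ℤ) (μ : obj n),
    μ ∈ (obj n).gr i → act σ μ ∈ (obj n).gr i
  act_d : ∀ {n : ℕ} (σ : Equiv.Perm (Fin n)) (μ : obj n),
    (obj n).d (act σ μ) = act σ ((obj n).d μ)

theorem SymSeq.act_sgn (O : SymSeq.{u, s} R) {n : ℕ} (σ : Equiv.Perm (Fin n)) (k : ℤ) :
    (O.obj n).sgn k ∘ₗ O.act σ = O.act σ ∘ₗ (O.obj n).sgn k := by
  refine (O.obj n).hom_ext fun i μ hμ => ?_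
  simp only [LinearMap.comp_apply]
  rw [GrMod.sgn_apply _ k hμ, GrMod.sgn_apply _ k (O.act_mem σ i μ hμ), map_smul]

/-- The submodule of `O(n) ⊗ A^{⊗ n}` spanned by all `(μ · σ) ⊗ x - μ ⊗ (σ · x)`. -/
def schurRel (O : SymSeq.{u, s} R) (A : GrMod.{u, v} R) (n : ℕ) :
    Submodule R (O.obj n ⊗[R] TPow A n) :=
  Submodule.span R {y | ∃ (σ : Equiv.Perm (Fin n)) (μ : O.obj n) (x : TPow A n),
    y = O.act σ μ ⊗ₜ[R] x - μ ⊗ₜ[R] permTensor A σ x}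

/-- The summand `O(n) ⊗_{Σ_n} A^{⊗ n}` of the Schur functor. -/
abbrev SchurSummand (O : SymSeq.{u, s} R) (A : GrMod.{u, v} R) (n : ℕ) : Type (max s u v) :=
  (O.obj n ⊗[R] TPow A n) ⧸ schurRel O A n

/-- The Schur functor `O[A] = ⨁_n O(n) ⊗_{Σ_n} A^{⊗ n}`. -/
abbrev Schur (O : SymSeq.{u, s} R) (A : GrMod.{u, v} R) : Type (max s u v) :=
  ⨁ n : ℕ, SchurSummand O A n

/-- The canonical map `O(n) ⊗ A^{⊗ n} → O[A]`. -/
def schurMk (O : SymSeq.{u, s} R) (A : GrMod.{u, v} R) (n : ℕ) :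
    O.obj n ⊗[R] TPow A n →ₗ[R] Schur O A :=
  DirectSum.lof R ℕ (SchurSummand O A) n ∘ₗ (schurRel O A n).mkQ

/-- The component of degree `m` of `O[A]`. -/
def schurGr (O : SymSeq.{u, s} R) (A : GrMod.{u, v} R) (m : ℤ) : Submodule R (Schur O A) :=
  Submodule.span R {y | ∃ (n : ℕ) (i j : ℤ) (μ : O.obj n) (x : TPow A n),
    μ ∈ (O.obj n).gr i ∧ x ∈ tgr A n j ∧ i + j = m ∧ y = schurMk O A n (μ ⊗ₜ[R] x)}

theorem schurRel_le_comap (O : SymSeq.{u, s} R) {n : ℕ}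
    (φ : O.obj n →ₗ[R] O.obj n) (F : TPow A n →ₗ[R] TPow B n)
    (hφ : ∀ σ : Equiv.Perm (Fin n), φ ∘ₗ O.act σ = O.act σ ∘ₗ φ)
    (hF : ∀ σ : Equiv.Perm (Fin n), F ∘ₗ permTensor A σ = permTensor B σ ∘ₗ F) :
    schurRel O A n ≤ (schurRel O B n).comap (TensorProduct.map φ F) := by
  refine Submodule.span_le.mpr ?_
  rintro _ ⟨σ, μ, x, rfl⟩
  refine Submodule.subset_span ⟨σ, φ μ, F x, ?_⟩
  have h1 := LinearMap.congr_fun (hφ σ) μ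
  have h2 := LinearMap.congr_fun (hF σ) x
  simp only [LinearMap.comp_apply] at h1 h2
  simp [h1, h2]

/-- The map `O[f] = ⨁_n 1 ⊗_{Σ_n} f_n` induced by a symmetric thick map `f` of degree `k`;
explicitly `μ ⊗ x ↦ (-1) ^ (k * |μ|) μ ⊗ f_n x`. -/
def schurMap (O : SymSeq.{u, s} R) (k : ℤ) (f : ThickFam A B) (hf : IsSymmetric f) :
    Schur O A →ₗ[R] Schur O B :=
  DirectSum.lmap fun n => Submodule.mapQ _ _ (TensorProduct.map ((O.obj n).sgn k) (f n))
    (schurRel_le_comap O _ _ (fun σ => O.act_sgn σ k) (hf n))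

/-- The differential of `O[A]`, induced by the tensor product differential
`μ ⊗ x ↦ d μ ⊗ x + (-1) ^ |μ| μ ⊗ d x` on `O(n) ⊗ A^{⊗ n}`. -/
def schurDiff (O : SymSeq.{u, s} R) (A : ChainCx.{u, v} R) :
    Schur O A.toGrMod →ₗ[R] Schur O A.toGrMod :=
  DirectSum.lmap fun n =>
    Submodule.mapQ _ _ (TensorProduct.map (O.obj n).d LinearMap.id)
        (schurRel_le_comap O _ _ (fun σ => LinearMap.ext fun μ => O.act_d σ μ) fun _ => rfl) +
      Submodule.mapQ _ _ (TensorProduct.map ((O.obj n).sgn (-1)) (tdiff A n))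
        (schurRel_le_comap O _ _ (fun σ => O.act_sgn σ (-1))
          fun σ => derivExt_permTensor A.toGrMod (-1) A.d A.d_mem σ)

/-! ## Operads and their algebras -/

/-- The lexicographic identification of the concatenation of `n` blocks of sizes `k i` with
`Fin m`, where `m = ∑ i, k i`. -/
def blockEquiv {n m : ℕ} (k : Fin n → ℕ) (h : ∑ i, k i = m) : ((i : Fin n) × Fin (k i)) ≃ Fin m :=
  finSigmaFinEquiv.trans (finCongr h)

theorem sum_blocks {n m N : ℕ} (k : Fin n → ℕ) (h : ∑ i, k i = m) (l : ∀ i, Fin (k i) → ℕ)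
    (hN : ∑ i, ∑ j, l i j = N) :
    ∑ q : Fin m, l ((blockEquiv k h).symm q).1 ((blockEquiv k h).symm q).2 = N := by
  rw [Equiv.sum_comp (blockEquiv k h).symm fun p : (i : Fin n) × Fin (k i) => l p.1 p.2,
    Fintype.sum_sigma, hN]

/-- The block permutation of `Fin m` that permutes the blocks: the block in position `i`, of size
`k (σ i)`, moves to position `σ i`. -/
def blockPerm {n m : ℕ} (σ : Equiv.Perm (Fin n)) (k : Fin n → ℕ) (h : ∑ i, k i = m)
    (h' : ∑ i, k (σ i) = m) : Equiv.Perm (Fin m) :=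
  (blockEquiv (fun i => k (σ i)) h').symm.trans
    ((Equiv.sigmaCongrLeft (β := fun i => Fin (k i)) σ).trans (blockEquiv k h))

/-- The direct sum `τ_1 ⊕ ⋯ ⊕ τ_n`, acting by `τ i` within the `i`-th block. -/
def blockSum {n m : ℕ} (k : Fin n → ℕ) (h : ∑ i, k i = m) (τ : ∀ i, Equiv.Perm (Fin (k i))) :
    Equiv.Perm (Fin m) :=
  (blockEquiv k h).symm.trans ((Equiv.sigmaCongrRight τ).trans (blockEquiv k h))

/-- The exponent `∑_{i<j} |x_i| |y_j|` of the Koszul sign of the shuffle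
`y_1 x_1 ⋯ y_n x_n ↦ y_1 ⋯ y_n x_1 ⋯ x_n`. -/
def shuffleExp {n : ℕ} (x y : Fin n → ℤ) : ℤ :=
  ∑ i, ∑ j, if i < j then x i * y j else 0

/-- A (symmetric, unital) operad in chain complexes: a symmetric sequence with a unit and
composition maps `γ(μ; ν_1, …, ν_n)`, i.e. morphisms of chain complexes
`O(n) ⊗ O(k_1) ⊗ ⋯ ⊗ O(k_n) → O(k_1 + ⋯ + k_n)`, that are equivariant, unital and associative. -/
structure Operad (R : Type u) [CommRing R] : Type (max u (s + 1)) extends SymSeq.{u, s} R where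
  one : obj 1
  one_mem : one ∈ (obj 1).gr 0
  d_one : (obj 1).d one = 0
  comp : ∀ {n m : ℕ} (k : Fin n → ℕ), ∑ i, k i = m →
    (obj n →ₗ[R] MultilinearMap R (fun i => (obj (k i) : Type s)) (obj m))
  comp_mem : ∀ {n m : ℕ} (k : Fin n → ℕ) (h : ∑ i, k i = m) (μ : obj n) (ν : ∀ i, obj (k i))
    (p : ℤ) (q : Fin n → ℤ), μ ∈ (obj n).gr p → (∀ i, ν i ∈ (obj (k i)).gr (q i)) →
    comp k h μ ν ∈ (obj m).gr (p + ∑ i, q i)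
  d_comp : ∀ {n m : ℕ} (k : Fin n → ℕ) (h : ∑ i, k i = m) (μ : obj n) (ν : ∀ i, obj (k i))
    (p : ℤ) (q : Fin n → ℤ), μ ∈ (obj n).gr p → (∀ i, ν i ∈ (obj (k i)).gr (q i)) →
    (obj m).d (comp k h μ ν) = comp k h ((obj n).d μ) ν +
      ∑ i, sg R (p + ∑ j, if j < i then q j else 0) •
        comp k h μ (Function.update ν i ((obj (k i)).d (ν i)))
  comp_act_left : ∀ {n m : ℕ} (σ : Equiv.Perm (Fin n)) (k : Fin n → ℕ) (h : ∑ i, k i = m)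
    (h' : ∑ i, k (σ i) = m) (μ : obj n) (ν : ∀ i, obj (k i)) (q : Fin n → ℤ),
    (∀ i, ν i ∈ (obj (k i)).gr (q i)) →
    comp (fun i => k (σ i)) h' (act σ μ) (fun i => ν (σ i)) =
      sg R (koszulExp σ fun i => q (σ i)) • act (blockPerm σ k h h') (comp k h μ ν)
  comp_act_right : ∀ {n m : ℕ} (k : Fin n → ℕ) (h : ∑ i, k i = m)
    (τ : ∀ i, Equiv.Perm (Fin (k i))) (μ : obj n) (ν : ∀ i, obj (k i)),
    comp k h μ (fun i => act (τ i) (ν i)) = act (blockSum k h τ) (comp k h μ ν)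
  one_comp : ∀ {n : ℕ} (μ : obj n), comp (fun _ : Fin 1 => n) (by simp) one (fun _ => μ) = μ
  comp_one : ∀ {n : ℕ} (μ : obj n), comp (fun _ : Fin n => 1) (by simp) μ (fun _ => one) = μ
  assoc : ∀ {n m N : ℕ} (k : Fin n → ℕ) (h : ∑ i, k i = m) (l : ∀ i, Fin (k i) → ℕ)
    (hN : ∑ i, ∑ j, l i j = N) (μ : obj n) (ν : ∀ i, obj (k i)) (ξ : ∀ i j, obj (l i j))
    (q : Fin n → ℤ) (r : ∀ i, Fin (k i) → ℤ), (∀ i, ν i ∈ (obj (k i)).gr (q i)) →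
    (∀ i j, ξ i j ∈ (obj (l i j)).gr (r i j)) →
    comp (fun i => ∑ j, l i j) hN μ (fun i => comp (l i) rfl (ν i) (ξ i)) =
      sg R (shuffleExp (fun i => ∑ j, r i j) q) •
        comp (fun a => l ((blockEquiv k h).symm a).1 ((blockEquiv k h).symm a).2)
          (sum_blocks k h l hN) (comp k h μ ν)
          (fun a => ξ ((blockEquiv k h).symm a).1 ((blockEquiv k h).symm a).2)

/-- `γ : O[A] → A` makes the chain complex `A` an algebra over the operad `O`: it is a morphism of
chain complexes that satisfies the unit and associativity constraints. -/
structure IsAlgebra (O : Operad.{u, s} R) (A : ChainCx.{u, v} R)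
    (γ : Schur O.toSymSeq A.toGrMod →ₗ[R] A) : Prop where
  deg : ∀ (m : ℤ) (y : Schur O.toSymSeq A.toGrMod),
    y ∈ schurGr O.toSymSeq A.toGrMod m → γ y ∈ A.gr m
  chain : A.d ∘ₗ γ = γ ∘ₗ schurDiff O.toSymSeq A
  unit : ∀ a : A,
    γ (schurMk O.toSymSeq A.toGrMod 1 (O.one ⊗ₜ[R] PiTensorProduct.tprod R fun _ => a)) = a
  assoc : ∀ {n m : ℕ} (k : Fin n → ℕ) (h : ∑ i, k i = m) (μ : O.obj n) (ν : ∀ i, O.obj (k i))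
    (a : ∀ i, Fin (k i) → A) (q : Fin n → ℤ) (δ : ∀ i, Fin (k i) → ℤ),
    (∀ i, ν i ∈ (O.obj (k i)).gr (q i)) → (∀ i j, a i j ∈ A.gr (δ i j)) →
    γ (schurMk O.toSymSeq A.toGrMod n (μ ⊗ₜ[R] PiTensorProduct.tprod R fun i =>
        γ (schurMk O.toSymSeq A.toGrMod (k i) (ν i ⊗ₜ[R] PiTensorProduct.tprod R (a i))))) =
      sg R (shuffleExp (fun i => ∑ j, δ i j) q) •
        γ (schurMk O.toSymSeq A.toGrMod m (O.comp k h μ ν ⊗ₜ[R] PiTensorProduct.tprod R fun b =>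
          a ((blockEquiv k h).symm b).1 ((blockEquiv k h).symm b).2))

/-- Thick maps of `O`-algebras of degree `k`: symmetric thick maps `f` with
`γ_B ∘ O[f] = f_1 ∘ γ_A`. -/
structure IsAlgThickMap (O : SymSeq.{u, s} R) (γA : Schur O A →ₗ[R] A) (γB : Schur O B →ₗ[R] B)
    (k : ℤ) (f : ThickFam A B) : Prop where
  deg : IsThick k f
  symmetric : IsSymmetric f
  comm : γB ∘ₗ schurMap O k f symmetric = f.level1 ∘ₗ γA

/-- A thick contraction of `O`-algebras from `(A, γA)` to `(B, γB)`. -/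
structure IsAlgThickContraction (O : Operad.{u, s} R)
    (A : ChainCx.{u, v} R) (γA : Schur O.toSymSeq A.toGrMod →ₗ[R] A)
    (B : ChainCx.{u, w} R) (γB : Schur O.toSymSeq B.toGrMod →ₗ[R] B)
    (f : ThickFam A.toGrMod B.toGrMod) (g : ThickFam B.toGrMod A.toGrMod)
    (h : ThickFam A.toGrMod A.toGrMod) : Prop where
  contraction : IsThickContraction A B f g h
  algebra_A : IsAlgebra O A γA
  algebra_B : IsAlgebra O B γB
  morphism_f : IsMorphism f
  morphism_g : IsMorphism g
  pseudo_h : IsPseudoDerivation h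
  alg_f : IsAlgThickMap O.toSymSeq γA γB 0 f
  alg_g : IsAlgThickMap O.toSymSeq γB γA 0 g
  alg_h : IsAlgThickMap O.toSymSeq γA γA 1 h

end

end ThickHPT

end

noncomputable section

namespace ThickHPT

universe u v w z s

/-! Level by level this is the ordinary perturbation lemma, a computation in the ring of
endomorphisms of `A^{⊗ n}`. With `s = (1 - ht)⁻¹` one has `1 + tsh = (1 - th)⁻¹`, and the perturbed
maps become `g' = sg`, `h' = sh`, `f' = f(1 + tsh)`, `t' = ftsg`. The contraction identities then
follow from `pert_mul_s` and `pert_homotopy`, which involve only `d`, `t`, `h`, `s` and the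
projection `p = gf`.

The real content is multiplicativity. On `A^{⊗ p} ⊗ A^{⊗ q}` the differential and the perturbation
are sums `d₁ + d₂`, `t₁ + t₂`, and the projection is a product `p₁p₂`, but `h` is tied to `h₁`, `h₂`
only by the pseudo-derivation relations, and these do not directly give `s = s₁s₂`. They do give
equality on the image of the projection (`s_mul_p`): the element `X = s₁s₂p₁p₂` is killed by `h`, is
carried by `d + t` to a right multiple of itself, and is sent to `p₁p₂` by the projection. Applying
the homotopy identity to `X` then forces `(1 - ht)X = p₁p₂`. Composing with `g ⊗ g` shows that `sg`
is a morphism, and compressing by `f ⊗ f` and `g ⊗ g` shows that `t'` is a derivation (`p_t_s_p`).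
The pseudo-derivation relation for `sh` is a direct computation (`pseudo_pert`).

The hypotheses are symmetric under reversing products, an operation that exchanges `s` with `1 +
tsh` and so the roles of `g'` and `f'`. Hence the statements about `f'` and the second
pseudo-derivation relation are read off in the opposite ring.

For the algebra structures, thick maps of `O`-algebras are closed under sums, composites and
inverses of `1 - n` (`one_sub_inverse`). Since `t` and `t'` are derivations, perturbing the
complexes adds exactly `O[t]` and `O[t']` to the differentials of the Schur functors, so `γ` stays a
chain map. -/

/-! ## Perturbed homotopies in a ring -/

section RingLemmas

variable {E : Type*} [Ring E]

/-- A perturbed contraction, seen inside a ring: `h` is a contracting homotopy from `1` to the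
projection `p`, and `s` is the inverse of `1 - h * t` for a perturbation `t` of `d`. -/
structure PertHomotopy (d t h s p : E) : Prop where
  homotopy : d * h + h * d = p - 1
  h_h : h * h = 0
  h_p : h * p = 0
  p_h : p * h = 0
  p_p : p * p = p
  d_p : d * p = p * d
  pert : d * t + t * d + t * t = 0
  left : s * (1 - h * t) = 1
  right : (1 - h * t) * s = 1

namespace PertHomotopy

variable {d t h s p : E} (P : PertHomotopy d t h s p)
include P

theorem s_eq : s = 1 + h * t * s := by
  have := P.right
  rw [sub_mul, one_mul] at this
  rw [← this]; abel

theorem s_eq' : s = 1 + s * h * t := by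
  have := P.left
  rw [mul_sub, mul_one, ← mul_assoc] at this
  rw [← this]; abel

theorem p_s : p * s = p := by
  rw [P.s_eq, mul_add, mul_one, ← mul_assoc, ← mul_assoc, P.p_h]; simp

theorem h_s : h * s = h := by
  rw [P.s_eq, mul_add, mul_one, ← mul_assoc, ← mul_assoc, P.h_h]; simp

/-- The usual passage from an inverse of `1 - ht` to an inverse of `1 - th`. The element `1 + tsh`
plays the role of `s` after reversing products. -/
theorem right' : (1 - t * h) * (1 + t * s * h) = 1 := by
  linear_combination (norm := noncomm_ring) t * P.right * h

theorem left' : (1 + t * s * h) * (1 - t * h) = 1 := by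
  linear_combination (norm := noncomm_ring) t * P.left * h

theorem s_h : s * h = h * (1 + t * s * h) := by
  conv_lhs => rw [P.s_eq]
  noncomm_ring

/-- The perturbed contraction in the opposite ring. -/
theorem op : PertHomotopy (MulOpposite.op d) (MulOpposite.op t) (MulOpposite.op h)
    (MulOpposite.op (1 + t * s * h)) (MulOpposite.op p) where
  homotopy := by
    simp only [← MulOpposite.op_mul, ← MulOpposite.op_add, ← MulOpposite.op_sub,
      ← MulOpposite.op_one]
    rw [add_comm, P.homotopy]
  h_h := by rw [← MulOpposite.op_mul, P.h_h, MulOpposite.op_zero]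
  h_p := by rw [← MulOpposite.op_mul, P.p_h, MulOpposite.op_zero]
  p_h := by rw [← MulOpposite.op_mul, P.h_p, MulOpposite.op_zero]
  p_p := by rw [← MulOpposite.op_mul, P.p_p]
  d_p := by rw [← MulOpposite.op_mul, ← MulOpposite.op_mul, P.d_p]
  pert := by
    simp only [← MulOpposite.op_mul, ← MulOpposite.op_add]
    rw [add_comm (t * d), P.pert, MulOpposite.op_zero]
  left := by
    simp only [← MulOpposite.op_mul, ← MulOpposite.op_sub, ← MulOpposite.op_one, P.right']
  right := by
    simp only [← MulOpposite.op_mul, ← MulOpposite.op_sub, ← MulOpposite.op_one, P.left']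

/-- The perturbation equation turns `-h(td + t²)` into `hdt`, and the homotopy identity replaces
`hd` by `p - 1 - dh`. -/
theorem one_sub_mul_pert : (1 - h * t) * (d + t) = d * (1 - h * t) + p * t := by
  linear_combination (norm := noncomm_ring) P.homotopy * t - h * P.pert

/-- The perturbed differential commutes with `s` up to a correction. -/
theorem pert_mul_s : (d + t) * s = s * (d + p * t * s) := by
  linear_combination (norm := noncomm_ring) s * P.one_sub_mul_pert * s - P.left * ((d + t) * s)
    + s * d * P.right

/-- Multiplying by the invertible elements `1 - ht` on the left and `1 - th` on the right removes
every inverse, because `sh = h(1 - th)⁻¹`. What remains follows from the unperturbed homotopy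
identity and the perturbation equation. -/
theorem pert_homotopy : (d + t) * (s * h) + s * h * (d + t) = s * p * (1 + t * s * h) - 1 := by
  have key : (1 - h * t) * ((d + t) * (s * h) + s * h * (d + t)) * (1 - t * h) =
      (1 - h * t) * (s * p * (1 + t * s * h) - 1) * (1 - t * h) := by
    have h1 : s * h * (1 - t * h) = h := by
      rw [P.s_h, mul_assoc, P.left', mul_one]
    have h2 : (1 - h * t) * (s * h) = h := by rw [← mul_assoc, P.right, one_mul]
    have h3 : (1 - h * t) * (s * p * (1 + t * s * h)) * (1 - t * h) = p := by
      calc _ = ((1 - h * t) * s) * p * ((1 + t * s * h) * (1 - t * h)) := by noncomm_ring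
        _ = p := by rw [P.right, P.left', one_mul, mul_one]
    linear_combination (norm := noncomm_ring) (1 - h * t) * (d + t) * h1 + h2 * (d + t) * (1 - t * h)
      - h3 + P.homotopy - h * P.pert * h
  calc _ = (s * (1 - h * t)) * ((d + t) * (s * h) + s * h * (d + t)) *
          ((1 - t * h) * (1 + t * s * h)) := by rw [P.left, P.right', one_mul, mul_one]
    _ = s * ((1 - h * t) * ((d + t) * (s * h) + s * h * (d + t)) * (1 - t * h)) *
          (1 + t * s * h) := by noncomm_ring
    _ = (s * (1 - h * t)) * (s * p * (1 + t * s * h) - 1) *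
          ((1 - t * h) * (1 + t * s * h)) := by rw [key]; noncomm_ring
    _ = _ := by rw [P.left, P.right', one_mul, mul_one]

end PertHomotopy

/-! ### Tensor products of two perturbed contractions, inside a ring. -/

/-- The commutation relations, with Koszul signs, between the operators on the first and on the
second factor of a tensor product. -/
structure KoszulPair (d₁ t₁ h₁ s₁ p₁ d₂ t₂ h₂ s₂ p₂ : E) : Prop where
  odd : ∀ x ∈ ({d₁, t₁, h₁} : Set E), ∀ y ∈ ({d₂, t₂, h₂} : Set E), x * y = -(y * x)
  even_left : ∀ x ∈ ({s₁, p₁} : Set E), ∀ y ∈ ({d₂, t₂, h₂, s₂, p₂} : Set E), x * y = y * x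
  even_right : ∀ x ∈ ({d₁, t₁, h₁} : Set E), ∀ y ∈ ({s₂, p₂} : Set E), x * y = y * x

/-- The operators of two perturbed contractions and of one on their tensor product whose
homotopy satisfies the pseudo-derivation relations. -/
structure PseudoTensor (d₁ t₁ h₁ s₁ p₁ d₂ t₂ h₂ s₂ p₂ h s : E) : Prop where
  fst : PertHomotopy d₁ t₁ h₁ s₁ p₁
  snd : PertHomotopy d₂ t₂ h₂ s₂ p₂
  tot : PertHomotopy (d₁ + d₂) (t₁ + t₂) h s (p₁ * p₂)
  pair : KoszulPair d₁ t₁ h₁ s₁ p₁ d₂ t₂ h₂ s₂ p₂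
  pseudo : (h₁ - h₂) * h = h₁ * h₂
  pseudo' : -(h * (h₁ - h₂)) = h₁ * h₂

namespace PseudoTensor

variable {d₁ t₁ h₁ s₁ p₁ d₂ t₂ h₂ s₂ p₂ h s : E}
  (T : PseudoTensor d₁ t₁ h₁ s₁ p₁ d₂ t₂ h₂ s₂ p₂ h s)
include T

/-- Multiplying the second pseudo-derivation relation on the right by `h₂`, `p₂` or `p₁` kills the
right-hand side and one term of the left; this gives the three vanishing products. -/
theorem h_h₁_h₂ : h * h₁ * h₂ = 0 := by
  linear_combination (norm := noncomm_ring) -T.pseudo' * h₂ + h * T.snd.h_h - h₁ * T.snd.h_h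

theorem h_h₁_p₂ : h * h₁ * p₂ = 0 := by
  linear_combination (norm := noncomm_ring) -T.pseudo' * p₂ + h * T.snd.h_p - h₁ * T.snd.h_p

theorem h_h₂_p₁ : h * h₂ * p₁ = 0 := by
  have := T.pair.odd h₁ (by simp) h₂ (by simp)
  linear_combination (norm := noncomm_ring) T.pseudo' * p₁ + h * T.fst.h_p + this * p₁
    - h₂ * T.fst.h_p

/-- Expanding `sᵢ = 1 + hᵢtᵢsᵢ` and moving factors past each other, every term begins with one of
`hh₁h₂`, `hh₁p₂`, `hh₂p₁`, `hp₁p₂`, all of which vanish. -/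
theorem h_mul_s₁_s₂ : h * (s₁ * s₂ * (p₁ * p₂)) = 0 := by
  have e1 := T.fst.s_eq
  have e2 := T.snd.s_eq
  have c1 := T.pair.even_left s₁ (by simp) s₂ (by simp)
  have c2 := T.pair.even_left s₁ (by simp) p₂ (by simp)
  have c3 := T.pair.even_left p₁ (by simp) p₂ (by simp)
  have c4 := T.pair.even_right t₁ (by simp) s₂ (by simp)
  have c5 := T.pair.even_right t₁ (by simp) p₂ (by simp)
  have c6 := T.pair.even_left p₁ (by simp) s₂ (by simp)
  have c7 := T.pair.even_left p₁ (by simp) t₂ (by simp)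
  have a1 : h * h₁ * (s₂ * p₂) = 0 := by
    rw [e2]
    linear_combination (norm := noncomm_ring) T.h_h₁_p₂ + T.h_h₁_h₂ * (t₂ * s₂ * p₂)
  have a2 : h * (s₂ * (p₁ * p₂)) = 0 := by
    calc _ = h * p₁ * p₂ + h * h₂ * t₂ * (s₂ * p₁) * p₂ := by
          conv_lhs => rw [e2]
          noncomm_ring
      _ = h * (p₁ * p₂) + h * h₂ * (t₂ * p₁) * s₂ * p₂ := by rw [← c6]; noncomm_ring
      _ = h * (p₁ * p₂) + h * h₂ * p₁ * t₂ * s₂ * p₂ := by rw [← c7]; noncomm_ring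
      _ = 0 := by rw [T.tot.h_p, T.h_h₂_p₁]; simp
  calc _ = h * (s₂ * (p₁ * p₂)) + h * h₁ * (t₁ * (s₁ * s₂) * (p₁ * p₂)) := by
        conv_lhs => rw [e1]
        noncomm_ring
    _ = h * (s₂ * (p₁ * p₂)) + h * h₁ * (t₁ * s₂ * (s₁ * p₂) * p₁) := by
        rw [c1, c3]; noncomm_ring
    _ = h * (s₂ * (p₁ * p₂)) + h * h₁ * (s₂ * (t₁ * p₂) * s₁ * p₁) := by
        rw [c2, c4]; noncomm_ring
    _ = h * (s₂ * (p₁ * p₂)) + h * h₁ * (s₂ * p₂) * (t₁ * s₁ * p₁) := by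
        rw [c5]; noncomm_ring
    _ = 0 := by rw [a1, a2]; simp

/-- `s` and `s₁ ⊗ s₂` agree on the image of the projection. -/
theorem s_mul_p : s * (p₁ * p₂) = s₁ * s₂ * (p₁ * p₂) := by
  have c0 := T.pair.even_left p₁ (by simp) p₂ (by simp)
  have c1 := T.pair.even_left s₁ (by simp) s₂ (by simp)
  have c2 := T.pair.even_left s₁ (by simp) p₂ (by simp)
  have c6 := T.pair.even_left p₁ (by simp) s₂ (by simp)
  set X := s₁ * s₂ * (p₁ * p₂) with hX
  have X₁ : X = s₁ * p₁ * (s₂ * p₂) := by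
    calc X = s₁ * (s₂ * p₁) * p₂ := by rw [hX]; noncomm_ring
      _ = _ := by rw [← c6]; noncomm_ring
  have X₂ : X = s₂ * p₂ * (s₁ * p₁) := by
    calc X = s₂ * (s₁ * p₂) * p₁ := by rw [hX, c1, c0]; noncomm_ring
      _ = _ := by rw [c2]; noncomm_ring
  have hp : p₁ * p₂ * X = p₁ * p₂ := by
    calc _ = p₂ * (p₁ * s₁) * p₁ * (s₂ * p₂) := by rw [X₁, c0]; noncomm_ring
      _ = p₂ * (p₁ * p₁) * (s₂ * p₂) := by rw [T.fst.p_s]; noncomm_ring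
      _ = p₂ * (p₁ * s₂) * p₂ := by rw [T.fst.p_p]; noncomm_ring
      _ = p₂ * s₂ * (p₁ * p₂) := by rw [c6]; noncomm_ring
      _ = p₂ * p₂ * p₁ := by rw [T.snd.p_s, c0]; noncomm_ring
      _ = _ := by rw [T.snd.p_p, c0]
  -- In each factor `(dᵢ + tᵢ)sᵢpᵢ = sᵢpᵢ(dᵢ + tᵢsᵢpᵢ)`, by `pert_mul_s`; the last bracket then
  -- passes the other factor of `X`. Only the fact that `X` reappears on the left matters, so that
  -- `h` kills the result.
  have D₁ : (d₁ + t₁) * X = X * (d₁ + t₁ * s₁ * p₁) := by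
    have k1 := T.pair.even_right d₁ (by simp) s₂ (by simp)
    have k2 := T.pair.even_right d₁ (by simp) p₂ (by simp)
    have k3 := T.pair.even_right t₁ (by simp) s₂ (by simp)
    have k4 := T.pair.even_right t₁ (by simp) p₂ (by simp)
    have e1 : (d₁ + t₁) * (s₁ * p₁) = s₁ * p₁ * (d₁ + t₁ * s₁ * p₁) := by
      linear_combination (norm := noncomm_ring) T.fst.pert_mul_s * p₁ + s₁ * T.fst.d_p
    have e2 : (d₁ + t₁ * s₁ * p₁) * (s₂ * p₂) = s₂ * p₂ * (d₁ + t₁ * s₁ * p₁) := by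
      linear_combination (norm := noncomm_ring) k1 * p₂ + s₂ * k2 + t₁ * s₁ * c6 * p₂ +
        t₁ * c1 * p₁ * p₂ + k3 * s₁ * p₁ * p₂ + s₂ * t₁ * s₁ * c0 + s₂ * t₁ * c2 * p₁ +
        s₂ * k4 * s₁ * p₁
    rw [X₁, ← mul_assoc, e1, mul_assoc, e2]
    simp only [mul_assoc]
  have D₂ : (d₂ + t₂) * X = X * (d₂ + t₂ * s₂ * p₂) := by
    have k1 := T.pair.even_left s₁ (by simp) d₂ (by simp)
    have k2 := T.pair.even_left p₁ (by simp) d₂ (by simp)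
    have k3 := T.pair.even_left s₁ (by simp) t₂ (by simp)
    have k4 := T.pair.even_left p₁ (by simp) t₂ (by simp)
    have e1 : (d₂ + t₂) * (s₂ * p₂) = s₂ * p₂ * (d₂ + t₂ * s₂ * p₂) := by
      linear_combination (norm := noncomm_ring) T.snd.pert_mul_s * p₂ + s₂ * T.snd.d_p
    have e2 : (d₂ + t₂ * s₂ * p₂) * (s₁ * p₁) = s₁ * p₁ * (d₂ + t₂ * s₂ * p₂) := by
      linear_combination (norm := noncomm_ring) -k1 * p₁ - s₁ * k2 - t₂ * s₂ * c2 * p₁ -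
        t₂ * c1 * p₂ * p₁ - k3 * s₂ * p₂ * p₁ - s₁ * t₂ * s₂ * c0 - s₁ * t₂ * c6 * p₂ -
        s₁ * k4 * s₂ * p₂
    rw [X₂, ← mul_assoc, e1, mul_assoc, e2]
    simp only [mul_assoc]
  have hX0 : h * X = 0 := T.h_mul_s₁_s₂
  -- Apply `dh + hd = p - 1` to `X`: since `hX = 0` and `h(d + t)X = 0`, the left side is `-htX`,
  -- while `pX = p` by `hp`.
  have hq : (1 - h * (t₁ + t₂)) * X = p₁ * p₂ := by
    linear_combination (norm := noncomm_ring) hp + T.tot.homotopy * X - (d₁ + d₂) * hX0 -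
      h * D₁ - h * D₂ - hX0 * (d₁ + t₁ * s₁ * p₁) - hX0 * (d₂ + t₂ * s₂ * p₂)
  rw [← hq, ← mul_assoc, T.tot.left, one_mul]

/-- The perturbed homotopy `s * h` satisfies the pseudo-derivation relation. -/
theorem pseudo_pert : (s₁ * h₁ - s₂ * h₂) * (s * h) = s₁ * h₁ * (s₂ * h₂) := by
  have c1 := T.pair.even_left s₁ (by simp) s₂ (by simp)
  have c2 := T.pair.even_left s₁ (by simp) h₂ (by simp)
  have c3 := T.pair.even_right h₁ (by simp) s₂ (by simp)
  have a1 := T.pair.odd h₁ (by simp) h₂ (by simp)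
  have a2 := T.pair.odd h₁ (by simp) t₂ (by simp)
  have a3 := T.pair.odd t₁ (by simp) h₂ (by simp)
  -- Clear both inverses: pulling `s₁s₂` out leaves a bracket without inverses, to which the
  -- unperturbed relation applies in `M`. The factor `1 - (t₁ + t₂)h` that appears there cancels
  -- against `sh = h(1 - th)⁻¹`.
  have L : s₁ * s₂ * ((1 - h₂ * t₂) * h₁ - (1 - h₁ * t₁) * h₂) = s₁ * h₁ - s₂ * h₂ := by
    linear_combination (norm := noncomm_ring) s₁ * T.snd.left * h₁ - s₂ * T.fst.left * h₂ -
      c1 * (1 - h₁ * t₁) * h₂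
  have M : ((1 - h₂ * t₂) * h₁ - (1 - h₁ * t₁) * h₂) * h = h₁ * h₂ * (1 - (t₁ + t₂) * h) := by
    linear_combination (norm := noncomm_ring) T.pseudo - h₂ * a2 * h + a1 * t₂ * h + h₁ * a3 * h
  calc _ = (s₁ * h₁ - s₂ * h₂) * h * (1 + (t₁ + t₂) * s * h) := by rw [T.tot.s_h]; noncomm_ring
    _ = s₁ * s₂ * (((1 - h₂ * t₂) * h₁ - (1 - h₁ * t₁) * h₂) * h) * (1 + (t₁ + t₂) * s * h) := by
        rw [← L]; noncomm_ring
    _ = s₁ * s₂ * (h₁ * h₂) * ((1 - (t₁ + t₂) * h) * (1 + (t₁ + t₂) * s * h)) := by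
        rw [M]; noncomm_ring
    _ = s₁ * (s₂ * h₁) * h₂ := by rw [T.tot.right']; noncomm_ring
    _ = _ := by rw [← c3]; noncomm_ring

/-- The operators in the opposite ring. -/
theorem op : PseudoTensor (MulOpposite.op d₁) (MulOpposite.op t₁) (MulOpposite.op h₁)
    (MulOpposite.op (1 + t₁ * s₁ * h₁)) (MulOpposite.op p₁)
    (MulOpposite.op d₂) (MulOpposite.op t₂) (MulOpposite.op h₂)
    (MulOpposite.op (1 + t₂ * s₂ * h₂)) (MulOpposite.op p₂)
    (MulOpposite.op h) (MulOpposite.op (1 + (t₁ + t₂) * s * h)) where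
  fst := T.fst.op
  snd := T.snd.op
  tot := by
    rw [← MulOpposite.op_mul, ← T.pair.even_left p₁ (by simp) p₂ (by simp),
      ← MulOpposite.op_add, ← MulOpposite.op_add]
    exact T.tot.op
  pair := by
    have odd := T.pair.odd
    have el := T.pair.even_left
    have er := T.pair.even_right
    simp only [Set.mem_insert_iff, Set.mem_singleton_iff, forall_eq_or_imp, forall_eq] at odd el er
    obtain ⟨⟨dd, dt, dh⟩, ⟨td, tt, th⟩, ⟨hd, ht, hh⟩⟩ := odd
    obtain ⟨⟨sd, st, sh, ss, sp⟩, ⟨pd, pt, ph, ps, pp⟩⟩ := el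
    obtain ⟨⟨ds, dp⟩, ⟨ts, tp⟩, ⟨hs, hp⟩⟩ := er
    -- `1 + t₁s₁h₁` is even: the signs from `t₁` and `h₁` cancel against odd elements, and none
    -- arise against even ones. `r` is the same for the second factor.
    have l : ∀ y, s₁ * y = y * s₁ → (t₁ * y = -(y * t₁) ∧ h₁ * y = -(y * h₁) ∨
        t₁ * y = y * t₁ ∧ h₁ * y = y * h₁) →
        y * (1 + t₁ * s₁ * h₁) = (1 + t₁ * s₁ * h₁) * y := by
      rintro y k (⟨k1, k2⟩ | ⟨k1, k2⟩)
      · linear_combination (norm := noncomm_ring) k1 * s₁ * h₁ - t₁ * s₁ * k2 + t₁ * k * h₁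
      · linear_combination (norm := noncomm_ring) -k1 * s₁ * h₁ - t₁ * k * h₁ - t₁ * s₁ * k2
    have r : ∀ x, x * s₂ = s₂ * x → (x * t₂ = -(t₂ * x) ∧ x * h₂ = -(h₂ * x) ∨
        x * t₂ = t₂ * x ∧ x * h₂ = h₂ * x) →
        (1 + t₂ * s₂ * h₂) * x = x * (1 + t₂ * s₂ * h₂) := by
      rintro x k (⟨k1, k2⟩ | ⟨k1, k2⟩)
      · linear_combination (norm := noncomm_ring) -k1 * s₂ * h₂ + t₂ * k * h₂ + t₂ * s₂ * k2
      · linear_combination (norm := noncomm_ring) -k1 * s₂ * h₂ - t₂ * k * h₂ - t₂ * s₂ * k2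
    constructor <;>
    simp only [Set.mem_insert_iff, Set.mem_singleton_iff, forall_eq_or_imp, forall_eq,
      ← MulOpposite.op_mul, ← MulOpposite.op_neg, MulOpposite.op_inj]
    · refine ⟨⟨?_, ?_, ?_⟩, ⟨?_, ?_, ?_⟩, ⟨?_, ?_, ?_⟩⟩ <;>
        simp only [dd, dt, dh, td, tt, th, hd, ht, hh, neg_neg]
    · refine ⟨⟨l _ sd (.inl ⟨td, hd⟩), l _ st (.inl ⟨tt, ht⟩), l _ sh (.inl ⟨th, hh⟩), ?_,
        l _ sp (.inr ⟨tp, hp⟩)⟩, ⟨pd.symm, pt.symm, ph.symm, r _ ps (.inr ⟨pt, ph⟩), pp.symm⟩⟩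
      refine r _ ?_ (.inr ⟨(l _ st (.inl ⟨tt, ht⟩)).symm, (l _ sh (.inl ⟨th, hh⟩)).symm⟩)
      exact (l _ ss (.inr ⟨ts, hs⟩)).symm
    · exact ⟨⟨r _ ds (.inl ⟨dt, dh⟩), dp.symm⟩, ⟨r _ ts (.inl ⟨tt, th⟩), tp.symm⟩,
        ⟨r _ hs (.inl ⟨ht, hh⟩), hp.symm⟩⟩
  -- Reversing products exchanges the two pseudo-derivation relations; the sign is absorbed by `h₁h₂
  -- = -h₂h₁`.
  pseudo := by
    have := T.pair.odd h₁ (by simp) h₂ (by simp)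
    simp only [← MulOpposite.op_mul, ← MulOpposite.op_sub, MulOpposite.op_inj]
    rw [← neg_neg (h * (h₁ - h₂)), T.pseudo', this, neg_neg]
  pseudo' := by
    have := T.pair.odd h₁ (by simp) h₂ (by simp)
    simp only [← MulOpposite.op_mul, ← MulOpposite.op_sub, ← MulOpposite.op_neg,
      MulOpposite.op_inj]
    rw [T.pseudo, this, neg_neg]

/-- This is `s_mul_p` read in the opposite ring; it is what makes `f'` multiplicative. -/
theorem p_mul_s : p₁ * p₂ * (1 + (t₁ + t₂) * s * h) =
    p₁ * p₂ * ((1 + t₁ * s₁ * h₁) * (1 + t₂ * s₂ * h₂)) := by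
  have k := T.op.s_mul_p
  have c := T.op.pair.even_left _ (Set.mem_insert _ _) (MulOpposite.op (1 + t₂ * s₂ * h₂))
    (by simp)
  have c' := T.pair.even_left p₁ (by simp) p₂ (by simp)
  simp only [← MulOpposite.op_mul, MulOpposite.op_inj] at k c
  rw [c', k, ← c]

theorem pseudo_pert' : -(s * h * (s₁ * h₁ - s₂ * h₂)) = s₁ * h₁ * (s₂ * h₂) := by
  have k := T.op.pseudo_pert
  have c1 := T.pair.even_right h₁ (by simp) s₂ (by simp)
  have c2 := T.pair.even_left s₁ (by simp) h₂ (by simp)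
  have c3 := T.pair.even_left s₁ (by simp) s₂ (by simp)
  have a := T.pair.odd h₁ (by simp) h₂ (by simp)
  simp only [← MulOpposite.op_mul, ← MulOpposite.op_sub, MulOpposite.op_inj] at k
  rw [T.tot.s_h, T.fst.s_h, T.snd.s_h, k, ← T.fst.s_h, ← T.snd.s_h]
  linear_combination (norm := noncomm_ring) s₂ * c2 * h₁ + c3 * h₂ * h₁ - s₁ * s₂ * a -
    s₁ * c1 * h₂

/-- The transferred perturbation is a sum over the two factors. -/
theorem p_t_s_p : p₁ * p₂ * ((t₁ + t₂) * s) * (p₁ * p₂) =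
    p₁ * p₂ * (t₁ * s₁ + t₂ * s₂) * (p₁ * p₂) := by
  have c0 := T.pair.even_left p₁ (by simp) p₂ (by simp)
  have c1 := T.pair.even_left s₁ (by simp) s₂ (by simp)
  have k1 := T.pair.even_right t₁ (by simp) p₂ (by simp)
  have k2 := T.pair.even_left p₁ (by simp) t₂ (by simp)
  have k3 := T.pair.even_left s₁ (by simp) p₂ (by simp)
  have k4 := T.pair.even_left p₁ (by simp) s₂ (by simp)
  -- The inverse belonging to the factor on which `t` does not act travels left to its projection
  -- and is absorbed by `pᵢsᵢ = pᵢ`.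
  have e1 : p₁ * p₂ * (t₁ * (s₁ * s₂)) = p₁ * p₂ * (t₁ * s₁) := by
    linear_combination (norm := noncomm_ring) -p₁ * k1 * s₁ * s₂ - p₁ * t₁ * k3 * s₂ +
      p₁ * t₁ * s₁ * T.snd.p_s + p₁ * t₁ * k3 + p₁ * k1 * s₁
  have e2 : p₁ * p₂ * (t₂ * (s₁ * s₂)) = p₁ * p₂ * (t₂ * s₂) := by
    linear_combination (norm := noncomm_ring) p₁ * p₂ * t₂ * c1 + c0 * t₂ * s₂ * s₁ +
      p₂ * k2 * s₂ * s₁ + p₂ * t₂ * k4 * s₁ + p₂ * t₂ * s₂ * T.fst.p_s - p₂ * t₂ * k4 -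
      p₂ * k2 * s₂ - c0 * t₂ * s₂
  linear_combination (norm := noncomm_ring) p₁ * p₂ * (t₁ + t₂) * T.s_mul_p +
    (e1 + e2) * (p₁ * p₂)

end PseudoTensor

end RingLemmas

section

variable {R : Type u} [CommRing R] {A : GrMod.{u, v} R} {B : GrMod.{u, w} R} {C : GrMod.{u, z} R}

/-! ## Signs -/

theorem sg_one : sg R 1 = -1 := by simp [sg]

theorem sg_neg (m : ℤ) : sg R (-m) = sg R m := by simp [sg, Int.negOnePow_neg]

theorem sg_mul_self (m : ℤ) : sg R m * sg R m = 1 := by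
  rw [← sg_add, ← sg_zero]
  exact sg_congr ⟨m, by ring⟩

theorem GrMod.sgn_zero (A : GrMod.{u, v} R) : A.sgn 0 = LinearMap.id :=
  A.hom_ext fun i x hx => by simp [A.sgn_apply 0 hx, sg_zero]

theorem GrMod.sgn_comp_sgn (A : GrMod.{u, v} R) (k l : ℤ) : A.sgn k ∘ₗ A.sgn l = A.sgn (k + l) :=
  A.hom_ext fun i x hx => by
    rw [LinearMap.comp_apply, A.sgn_apply l hx, map_smul, A.sgn_apply k hx, A.sgn_apply _ hx,
      smul_smul, add_mul, sg_add, mul_comm]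

theorem GrMod.sgn_neg (A : GrMod.{u, v} R) (k : ℤ) : A.sgn (-k) = A.sgn k :=
  A.hom_ext fun i x hx => by
    rw [A.sgn_apply _ hx, A.sgn_apply _ hx, neg_mul, sg_neg]

theorem tsgn_zero (A : GrMod.{u, v} R) (n : ℕ) : tsgn A 0 n = LinearMap.id := by
  simp [tsgn, A.sgn_zero]

theorem tsgn_neg (A : GrMod.{u, v} R) (k : ℤ) (n : ℕ) : tsgn A (-k) n = tsgn A k n := by
  simp [tsgn, A.sgn_neg]

theorem tsgn_mul_self (A : GrMod.{u, v} R) (k : ℤ) (n : ℕ) :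
    tsgn A k n ∘ₗ tsgn A k n = LinearMap.id := by
  have : A.sgn k ∘ₗ A.sgn k = LinearMap.id := by
    nth_rw 1 [← A.sgn_neg k]
    rw [A.sgn_comp_sgn, neg_add_cancel, A.sgn_zero]
  rw [tsgn, ← PiTensorProduct.map_comp]
  simp [this]

theorem tprod_mem_tgr {n : ℕ} {δ : Fin n → ℤ} {a : Fin n → A} (ha : ∀ i, a i ∈ A.gr (δ i)) :
    PiTensorProduct.tprod R a ∈ tgr A n (∑ i, δ i) :=
  Submodule.subset_span ⟨δ, a, ha, rfl, rfl⟩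

theorem sg_sum {ι : Type*} (t : Finset ι) (δ : ι → ℤ) :
    sg R (∑ i ∈ t, δ i) = ∏ i ∈ t, sg R (δ i) := by
  classical
  induction t using Finset.induction_on with
  | empty => simp [sg_zero]
  | insert i t hi ih => rw [Finset.sum_insert hi, Finset.prod_insert hi, sg_add, ih]

theorem tsgn_apply (k : ℤ) {n : ℕ} {m : ℤ} {x : TPow A n} (hx : x ∈ tgr A n m) :
    tsgn A k n x = sg R (k * m) • x := by
  have : tgr A n m ≤ LinearMap.eqLocus (tsgn A k n) (sg R (k * m) • LinearMap.id) := by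
    refine Submodule.span_le.mpr ?_
    rintro _ ⟨δ, a, ha, rfl, rfl⟩
    rw [SetLike.mem_coe, LinearMap.mem_eqLocus, LinearMap.smul_apply, LinearMap.id_apply, tsgn,
      PiTensorProduct.map_tprod, Finset.mul_sum, sg_sum, ← MultilinearMap.map_smul_univ]
    congr 1
    funext i
    exact A.sgn_apply k (ha i)
  exact this hx

/-! ## Degrees -/

namespace IsThick

variable {k l : ℤ} {f f' : ThickFam A B} {g : ThickFam B C}

theorem comp (hg : IsThick l g) (hf : IsThick k f) {i : ℤ} (hi : k + l = i := by norm_num) :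
    IsThick i (g.comp f) := fun n m x hx => by
  rw [← hi, ← add_assoc]
  exact hg n _ _ (hf n m x hx)

theorem add (hf : IsThick k f) (hf' : IsThick k f') : IsThick k (f + f') := fun n m x hx =>
  Submodule.add_mem _ (hf n m x hx) (hf' n m x hx)

theorem comp_tsgn (hf : IsThick k f) (l : ℤ) (n : ℕ) :
    f n ∘ₗ tsgn A l n = sg R (l * k) • (tsgn B l n ∘ₗ f n) := by
  refine tpow_hom_ext A fun δ a ha => ?_
  have hx := tprod_mem_tgr (R := R) ha
  rw [LinearMap.comp_apply, tsgn_apply l hx, map_smul, LinearMap.smul_apply, LinearMap.comp_apply,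
    tsgn_apply l (hf n _ _ hx), smul_smul]
  congr 1
  rw [mul_add, sg_add, mul_comm (sg R (l * k)), mul_assoc, sg_mul_self, mul_one]

/-- `A^{⊗ 0}` is concentrated in degree `0`. This settles level `0`, which an induction that splits
off one factor at a time leaves open. -/
theorem apply_zero (hf : IsThick k f) (hk : k ≠ 0) : f 0 = 0 := by
  refine tpow_hom_ext A fun δ a ha => ?_
  have h1 := hf 0 _ _ (tprod_mem_tgr (R := R) ha)
  have h2 : tgr B 0 (∑ i, δ i + k) = ⊥ := by
    rw [tgr, Submodule.span_eq_bot]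
    rintro _ ⟨ε, b, -, hε, -⟩
    simp at hε
    exact absurd hε.symm hk
  rw [h2] at h1
  simpa using h1

end IsThick

/-! ## Level one -/

theorem ThickFam.level1_apply (f : ThickFam A B) (x : A) :
    f.level1 x = PiTensorProduct.subsingletonEquiv (R := R) (s := fun _ : Fin 1 => (B : Type w)) 0
      (f 1 (PiTensorProduct.tprod R fun _ => x)) := by
  simp only [ThickFam.level1, LinearMap.comp_apply, LinearEquiv.coe_coe]
  congr 2
  exact PiTensorProduct.subsingletonEquiv_symm_apply' (R := R) (0 : Fin 1) x

theorem ThickFam.apply_one_tprod (f : ThickFam A B) (x : A) :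
    f 1 (PiTensorProduct.tprod R fun _ => x) = PiTensorProduct.tprod R fun _ => f.level1 x := by
  rw [ThickFam.level1_apply, ← PiTensorProduct.subsingletonEquiv_symm_apply' (R := R) (0 : Fin 1)
    (PiTensorProduct.subsingletonEquiv (R := R) (s := fun _ : Fin 1 => (B : Type w)) 0 _)]
  exact (LinearEquiv.symm_apply_apply _ _).symm

theorem ThickFam.level1_eq {f : ThickFam A B} {x : A} {y : B}
    (h : f 1 (PiTensorProduct.tprod R fun _ => x) = PiTensorProduct.tprod R fun _ => y) :
    f.level1 x = y := by
  rw [ThickFam.level1_apply, h, PiTensorProduct.subsingletonEquiv_apply_tprod]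

theorem ThickFam.level1_comp (g : ThickFam B C) (f : ThickFam A B) :
    (g.comp f).level1 = g.level1 ∘ₗ f.level1 := by
  ext x
  refine ThickFam.level1_eq ?_
  rw [ThickFam.comp, LinearMap.comp_apply, f.apply_one_tprod, g.apply_one_tprod]
  rfl

theorem ThickFam.level1_add (f f' : ThickFam A B) : (f + f').level1 = f.level1 + f'.level1 := by
  ext x
  simp [ThickFam.level1_apply]

theorem ThickFam.level1_id : (ThickFam.id A).level1 = LinearMap.id := by
  ext x
  exact ThickFam.level1_eq rfl

theorem IsThick.level1 {k : ℤ} {f : ThickFam A B} (hf : IsThick k f) (i : ℤ) (x : A)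
    (hx : x ∈ A.gr i) : f.level1 x ∈ B.gr (i + k) := by
  have h1 : PiTensorProduct.tprod R (fun _ : Fin 1 => x) ∈ tgr A 1 i := by
    simpa using tprod_mem_tgr (R := R) (δ := fun _ : Fin 1 => i) (a := fun _ => x) fun _ => hx
  have h2 := hf 1 i _ h1
  have h3 : tgr B 1 (i + k) ≤ (B.gr (i + k)).comap (PiTensorProduct.subsingletonEquiv (R := R)
      (s := fun _ : Fin 1 => (B : Type w)) 0).toLinearMap := by
    refine Submodule.span_le.mpr ?_
    rintro _ ⟨δ, a, ha, hδ, rfl⟩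
    simp only [Fin.sum_univ_one] at hδ
    rw [SetLike.mem_coe, Submodule.mem_comap, LinearEquiv.coe_coe,
      PiTensorProduct.subsingletonEquiv_apply_tprod, ← hδ]
    exact ha 0
  rw [ThickFam.level1_apply]
  exact h3 h2

theorem derivExt_one_tprod (k : ℤ) (t : A →ₗ[R] A) (x : A) :
    derivExt A k t 1 (PiTensorProduct.tprod R fun _ => x) = PiTensorProduct.tprod R fun _ => t x := by
  simp only [derivExt, Finset.univ_unique, Finset.sum_singleton, PiTensorProduct.map_tprod]
  congr 1
  funext j
  rw [Subsingleton.elim j default]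
  simp

theorem derivExt_add (k : ℤ) (t t' : A →ₗ[R] A) (n : ℕ) :
    derivExt A k (t + t') n = derivExt A k t n + derivExt A k t' n := by
  refine tpow_hom_ext A fun δ a ha => ?_
  rw [LinearMap.add_apply, derivExt_tprod A k _ ha, derivExt_tprod A k _ ha,
    derivExt_tprod A k _ ha, ← Finset.sum_add_distrib]
  refine Finset.sum_congr rfl fun i _ => ?_
  rw [LinearMap.add_apply, MultilinearMap.map_update_add, smul_add]

/-- The extension of a homogeneous map as a derivation is homogeneous. -/
theorem isThick_derivExt {k : ℤ} {t : A →ₗ[R] A}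
    (ht : ∀ (i : ℤ) (x : A), x ∈ A.gr i → t x ∈ A.gr (i + k)) :
    IsThick k (derivExt A k t) := by
  intro n m
  change tgr A n m ≤ (tgr A n (m + k)).comap (derivExt A k t n)
  refine Submodule.span_le.mpr ?_
  rintro _ ⟨δ, a, ha, rfl, rfl⟩
  rw [SetLike.mem_coe, Submodule.mem_comap, derivExt_tprod A k t ha]
  refine Submodule.sum_mem _ fun i _ => Submodule.smul_mem _ _ ?_
  have hs : ∑ j, δ j + k = ∑ j, Function.update δ i (δ i + k) j := by
    rw [Finset.sum_update_of_mem (Finset.mem_univ i),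
      ← Finset.add_sum_erase _ _ (Finset.mem_univ i), Finset.sdiff_singleton_eq_erase]
    ring
  rw [hs]
  refine tprod_mem_tgr fun j => ?_
  by_cases h : j = i
  · subst h; simpa using ht _ _ (ha j)
  · simpa [h] using ha j

/-! ## Decomposition of tensor powers -/

theorem linearMap_sum_comp {ι M N P : Type*} [AddCommGroup M] [Module R M] [AddCommGroup N]
    [Module R N] [AddCommGroup P] [Module R P] (t : Finset ι) (f : ι → N →ₗ[R] P) (g : M →ₗ[R] N) :
    (∑ i ∈ t, f i) ∘ₗ g = ∑ i ∈ t, f i ∘ₗ g :=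
  LinearMap.ext fun x => by simp

theorem linearMap_comp_sum {ι M N P : Type*} [AddCommGroup M] [Module R M] [AddCommGroup N]
    [Module R N] [AddCommGroup P] [Module R P] (t : Finset ι) (f : ι → M →ₗ[R] N) (g : N →ₗ[R] P) :
    g ∘ₗ (∑ i ∈ t, f i) = ∑ i ∈ t, g ∘ₗ f i :=
  LinearMap.ext fun x => by simp

theorem mulEquiv_tprod {M : Type*} [AddCommGroup M] [Module R M] {p q : ℕ} (a : Fin p → M)
    (b : Fin q → M) :
    TensorPower.mulEquiv (PiTensorProduct.tprod R a ⊗ₜ[R] PiTensorProduct.tprod R b) =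
      PiTensorProduct.tprod R (Fin.append a b) :=
  TensorPower.tprod_mul_tprod R a b

theorem map_comp_mulEquiv {M N : Type*} [AddCommGroup M] [Module R M] [AddCommGroup N] [Module R N]
    {p q : ℕ} (F : Fin (p + q) → M →ₗ[R] N) :
    PiTensorProduct.map F ∘ₗ (TensorPower.mulEquiv (R := R) (M := M) (n := p) (m := q)).toLinearMap =
      (TensorPower.mulEquiv (R := R) (M := N) (n := p) (m := q)).toLinearMap ∘ₗ
        TensorProduct.map (PiTensorProduct.map fun i => F (Fin.castAdd q i))
          (PiTensorProduct.map fun i => F (Fin.natAdd p i)) := by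
  refine TensorProduct.ext (PiTensorProduct.ext (MultilinearMap.ext fun a =>
    PiTensorProduct.ext (MultilinearMap.ext fun b => ?_)))
  simp only [LinearMap.compMultilinearMap_apply, LinearMap.compr₂ₛₗ_apply, TensorProduct.mk_apply,
    LinearMap.comp_apply, LinearEquiv.coe_coe, TensorProduct.map_tmul, PiTensorProduct.map_tprod,
    mulEquiv_tprod]
  congr 1
  funext i
  refine Fin.addCases (fun i => ?_) (fun i => ?_) i <;> simp

/-- The Leibniz rule: the sum over positions splits at `p`, and a position in the right block has
the sign operator on all `p` left slots, which is `tsgn`. -/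
theorem derivExt_comp_mulEquiv (k : ℤ) (t : A →ₗ[R] A) (p q : ℕ) :
    derivExt A k t (p + q) ∘ₗ (TensorPower.mulEquiv (R := R) (M := A) (n := p) (m := q)).toLinearMap =
      (TensorPower.mulEquiv (R := R) (M := A) (n := p) (m := q)).toLinearMap ∘ₗ
        (TensorProduct.map (derivExt A k t p) LinearMap.id +
          TensorProduct.map (tsgn A k p) (derivExt A k t q)) := by
  have hl : ∀ q : ℕ, TensorProduct.map (derivExt A k t p) (LinearMap.id : TPow A q →ₗ[R] TPow A q) =
      ∑ i : Fin p, TensorProduct.map (PiTensorProduct.map fun j =>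
        if j < i then A.sgn k else if j = i then t else LinearMap.id) LinearMap.id := by
    intro q
    exact map_sum ((TensorProduct.mapBilinear (RingHom.id R) (TPow A p) (TPow A q) (TPow A p)
      (TPow A q)).flip LinearMap.id) _ _
  have hr : TensorProduct.map (tsgn A k p) (derivExt A k t q) =
      ∑ i : Fin q, TensorProduct.map (tsgn A k p) (PiTensorProduct.map fun j =>
        if j < i then A.sgn k else if j = i then t else LinearMap.id) :=
    map_sum (TensorProduct.mapBilinear (RingHom.id R) (TPow A p) (TPow A q) (TPow A p)
      (TPow A q) (tsgn A k p)) _ _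
  rw [derivExt, Fin.sum_univ_add, LinearMap.add_comp, LinearMap.comp_add, hl, hr]
  congr 1
  · rw [linearMap_sum_comp, linearMap_comp_sum]
    refine Finset.sum_congr rfl fun i _ => ?_
    rw [map_comp_mulEquiv]
    congr 2
    · congr 1
      funext j
      simp only [Fin.lt_def, Fin.val_castAdd, Fin.castAdd_inj]
    · rw [← PiTensorProduct.map_id]
      congr 1
      funext j
      have h1 : ¬ Fin.natAdd p j < Fin.castAdd q i := by
        simp only [Fin.lt_def, Fin.val_natAdd, Fin.val_castAdd]; omega
      have h2 : ¬ Fin.natAdd p j = Fin.castAdd q i := by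
        simp only [Fin.ext_iff, Fin.val_natAdd, Fin.val_castAdd]; omega
      simp only [h1, h2, if_false]
  · rw [linearMap_sum_comp, linearMap_comp_sum]
    refine Finset.sum_congr rfl fun i _ => ?_
    rw [map_comp_mulEquiv]
    congr 2
    · rw [tsgn]
      congr 1
      funext j
      have h1 : Fin.castAdd q j < Fin.natAdd p i := by
        simp only [Fin.lt_def, Fin.val_natAdd, Fin.val_castAdd]; omega
      simp only [h1, if_true]
    · congr 1
      funext j
      simp only [Fin.natAdd_lt_natAdd_iff, Fin.natAdd_inj]

theorem IsMorphism.comp_mulEquiv {f : ThickFam A B} (hf : IsMorphism f) (p q : ℕ) :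
    f (p + q) ∘ₗ (TensorPower.mulEquiv (R := R) (M := A) (n := p) (m := q)).toLinearMap =
      (TensorPower.mulEquiv (R := R) (M := B) (n := p) (m := q)).toLinearMap ∘ₗ
        TensorProduct.map (f p) (f q) := by
  rw [hf (p + q), map_comp_mulEquiv, ← hf p, ← hf q]

/-- Linear maps on `A^{⊗ n+1}` agree if they agree on all `x ⊗ a`. -/
theorem tpow_succ_ext {M : Type*} [AddCommGroup M] [Module R M] {n : ℕ}
    {f g : TPow A (n + 1) →ₗ[R] M}
    (h : f ∘ₗ (TensorPower.mulEquiv (R := R) (M := A) (n := n) (m := 1)).toLinearMap =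
      g ∘ₗ (TensorPower.mulEquiv (R := R) (M := A) (n := n) (m := 1)).toLinearMap) : f = g := by
  ext1
  ext a
  obtain ⟨y, hy⟩ := (TensorPower.mulEquiv (R := R) (M := A) (n := n) (m := 1)).surjective
    (PiTensorProduct.tprod R a)
  have := LinearMap.congr_fun h y
  simp only [LinearMap.comp_apply, LinearEquiv.coe_coe, hy] at this
  exact this

theorem tpow_one_ext {M : Type*} [AddCommGroup M] [Module R M] {f g : TPow A 1 →ₗ[R] M}
    (h : ∀ x : A, f (PiTensorProduct.tprod R fun _ => x) = g (PiTensorProduct.tprod R fun _ => x)) :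
    f = g := by
  ext1
  ext a
  have : a = fun _ => a 0 := funext fun i => by rw [Subsingleton.elim i 0]
  rw [this]
  exact h (a 0)

/-- By induction on the level, only splittings `n + 1` are needed, so it suffices to use
pseudo-derivation data with `q = 1`. The derivation criterion below works the same way. -/
theorem isMorphism_of_comp_mulEquiv {f : ThickFam A B}
    (h₀ : f 0 = PiTensorProduct.map fun _ => f.level1)
    (h : ∀ n, f (n + 1) ∘ₗ (TensorPower.mulEquiv (R := R) (M := A) (n := n) (m := 1)).toLinearMap =
      (TensorPower.mulEquiv (R := R) (M := B) (n := n) (m := 1)).toLinearMap ∘ₗ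
        TensorProduct.map (f n) (f 1)) : IsMorphism f := by
  intro n
  induction n with
  | zero => exact h₀
  | succ n ih =>
    refine tpow_succ_ext ?_
    rw [h, map_comp_mulEquiv, ih]
    congr 2
    exact tpow_one_ext fun x => by rw [f.apply_one_tprod, PiTensorProduct.map_tprod]

theorem isDerivation_of_comp_mulEquiv {k : ℤ} {t : ThickFam A A}
    (h₀ : t 0 = 0)
    (h : ∀ n, t (n + 1) ∘ₗ (TensorPower.mulEquiv (R := R) (M := A) (n := n) (m := 1)).toLinearMap =
      (TensorPower.mulEquiv (R := R) (M := A) (n := n) (m := 1)).toLinearMap ∘ₗ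
        (TensorProduct.map (t n) LinearMap.id + TensorProduct.map (tsgn A k n) (t 1))) :
    IsDerivation k t := by
  intro n
  induction n with
  | zero => rw [h₀]; simp [derivExt]
  | succ n ih =>
    refine tpow_succ_ext ?_
    rw [h, derivExt_comp_mulEquiv, ih]
    congr 3
    exact tpow_one_ext fun x => by rw [t.apply_one_tprod, derivExt_one_tprod]

end

/-! ## The perturbed contraction, level by level -/

theorem PertHomotopy.map {E F : Type*} [Ring E] [Ring F] (φ : E →+* F) {d t h s p : E}
    (P : PertHomotopy d t h s p) : PertHomotopy (φ d) (φ t) (φ h) (φ s) (φ p) where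
  homotopy := by simp only [← map_mul, ← map_add, P.homotopy, map_sub, map_one]
  h_h := by rw [← map_mul, P.h_h, map_zero]
  h_p := by rw [← map_mul, P.h_p, map_zero]
  p_h := by rw [← map_mul, P.p_h, map_zero]
  p_p := by rw [← map_mul, P.p_p]
  d_p := by rw [← map_mul, P.d_p, map_mul]
  pert := by simp only [← map_mul, ← map_add, P.pert, map_zero]
  left := by rw [← map_mul, ← map_one φ, ← map_sub, ← map_mul, P.left]
  right := by rw [← map_mul, ← map_one φ, ← map_sub, ← map_mul, P.right]

/-- Multiplying the odd operators by a commuting involution. -/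
theorem PertHomotopy.twist {E : Type*} [Ring E] {d t h s p : E} (P : PertHomotopy d t h s p) {T : E}
    (hT : T * T = 1) (hd : d * T = T * d) (ht : t * T = T * t) (hh : h * T = T * h)
    (hp : p * T = T * p) : PertHomotopy (T * d) (T * t) (T * h) s p := by
  have key : ∀ x y : E, x * T = T * x → T * x * (T * y) = x * y := fun x y hx => by
    rw [mul_assoc, ← mul_assoc x, hx, ← mul_assoc, ← mul_assoc, hT, one_mul]
  constructor
  · rw [key _ _ hd, key _ _ hh, P.homotopy]
  · rw [key _ _ hh, P.h_h]
  · rw [mul_assoc, P.h_p, mul_zero]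
  · rw [← mul_assoc, hp, mul_assoc, P.p_h, mul_zero]
  · exact P.p_p
  · rw [mul_assoc, P.d_p, ← mul_assoc, ← hp, mul_assoc]
  · rw [key _ _ hd, key _ _ ht, key _ _ ht, P.pert]
  · rw [key _ _ hh, P.left]
  · rw [key _ _ hh, P.right]

section

variable {R : Type u} [CommRing R]

theorem neg_one_smul_linearMap {M N : Type*} [AddCommGroup M] [Module R M] [AddCommGroup N]
    [Module R N] (f : M →ₗ[R] N) : (-1 : R) • f = -f :=
  LinearMap.ext fun x => by simp

/-- The data of the perturbation lemma, apart from the algebra structures. -/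
structure ThickPert (A : ChainCx.{u, v} R) (B : ChainCx.{u, w} R)
    (f : ThickFam A.toGrMod B.toGrMod) (g : ThickFam B.toGrMod A.toGrMod)
    (h t s : ThickFam A.toGrMod A.toGrMod) : Prop where
  contraction : IsThickContraction A B f g h
  pert : IsThickPerturbation A t
  deg_s : IsThick 0 s
  left : s.comp (ThickFam.id A.toGrMod - h.comp t) = ThickFam.id A.toGrMod
  right : (ThickFam.id A.toGrMod - h.comp t).comp s = ThickFam.id A.toGrMod

namespace ThickPert

variable {A : ChainCx.{u, v} R} {B : ChainCx.{u, w} R}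
  {f : ThickFam A.toGrMod B.toGrMod} {g : ThickFam B.toGrMod A.toGrMod}
  {h t s : ThickFam A.toGrMod A.toGrMod} (H : ThickPert A B f g h t s)
include H

theorem tdiff_f (n : ℕ) : tdiff B n ∘ₗ f n = f n ∘ₗ tdiff A n := by
  have := congrFun H.contraction.bdry_f n
  simpa [ThickFam.bdry, sg_zero, sub_eq_zero] using this

theorem tdiff_g (n : ℕ) : tdiff A n ∘ₗ g n = g n ∘ₗ tdiff B n := by
  have := congrFun H.contraction.bdry_g n
  simpa [ThickFam.bdry, sg_zero, sub_eq_zero] using this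

theorem f_g (n : ℕ) : f n ∘ₗ g n = LinearMap.id := congrFun H.contraction.f_g n

theorem f_h (n : ℕ) : f n ∘ₗ h n = 0 := congrFun H.contraction.f_h n

theorem h_g (n : ℕ) : h n ∘ₗ g n = 0 := congrFun H.contraction.h_g n

/-- Brings each tensor level into the ring-theoretic setting, with projection `p = gf`. -/
theorem level (n : ℕ) :
    PertHomotopy (E := Module.End R (TPow A.toGrMod n)) (tdiff A n) (t n) (h n) (s n)
      (g n ∘ₗ f n) where
  homotopy := by
    have := congrFun H.contraction.bdry_h n
    rw [ThickFam.bdry, sg_one, neg_one_smul_linearMap, sub_neg_eq_add] at this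
    exact this
  h_h := congrFun H.contraction.h_h n
  h_p := by rw [Module.End.mul_eq_comp, ← LinearMap.comp_assoc, H.h_g, LinearMap.zero_comp]
  p_h := by rw [Module.End.mul_eq_comp, LinearMap.comp_assoc, H.f_h, LinearMap.comp_zero]
  p_p := by
    rw [Module.End.mul_eq_comp, LinearMap.comp_assoc, ← LinearMap.comp_assoc (f n), H.f_g,
      LinearMap.id_comp]
  d_p := by
    rw [Module.End.mul_eq_comp, Module.End.mul_eq_comp, LinearMap.comp_assoc, ← H.tdiff_f,
      ← LinearMap.comp_assoc, H.tdiff_g, LinearMap.comp_assoc]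
  pert := by
    have := congrFun H.pert.eq n
    rw [Pi.add_apply, ThickFam.bdry, sg_neg, sg_one, neg_one_smul_linearMap, sub_neg_eq_add] at this
    exact this
  left := congrFun H.left n
  right := congrFun H.right n

/-! ### The formulas for the perturbed maps -/

omit H in
theorem f_pert_eq (n : ℕ) :
    (f + f.comp ((t.comp s).comp h)) n =
      f n ∘ₗ (1 + t n * s n * h n : Module.End R (TPow A.toGrMod n)) := by
  simp [ThickFam.comp, LinearMap.comp_add, Module.End.one_eq_id, Module.End.mul_eq_comp]

/-- From `s = 1 + hts`. The closed forms of `g'`, `h'` and `f'` replace the perturbation series in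
all that follows. -/
theorem g_pert_eq : g + h.comp ((t.comp s).comp g) = s.comp g := by
  funext n
  change g n + (h n * (t n * s n) : Module.End R _) ∘ₗ g n = s n ∘ₗ g n
  conv_rhs => rw [(H.level n).s_eq]
  rw [LinearMap.add_comp, mul_assoc]
  rfl

theorem h_pert_eq : h + h.comp ((t.comp s).comp h) = s.comp h := by
  funext n
  have := (H.level n).s_h
  change h n + h n * (t n * s n * h n) = s n * h n
  rw [this, mul_add, mul_one]

theorem t_s_eq (n : ℕ) :
    (1 + t n * s n * h n : Module.End R (TPow A.toGrMod n)) * t n = t n * s n := by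
  nth_rw 2 [(H.level n).s_eq']
  noncomm_ring

theorem f_comp_s (n : ℕ) : f n ∘ₗ s n = f n := by
  rw [(H.level n).s_eq, LinearMap.comp_add, Module.End.mul_eq_comp, Module.End.mul_eq_comp,
    LinearMap.comp_assoc, ← LinearMap.comp_assoc _ _ (f n), H.f_h, LinearMap.zero_comp, add_zero]
  rfl

/-! ### The perturbed contraction -/

/-- Compose `pert_mul_s` with `g`: the correction term `gfts` factors through `g` and produces the
transferred perturbation. -/
theorem pert_g (n : ℕ) :
    (tdiff A n + t n) ∘ₗ (s n ∘ₗ g n) =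
      (s n ∘ₗ g n) ∘ₗ (tdiff B n + f n ∘ₗ (t n ∘ₗ s n) ∘ₗ g n) := by
  have k := (H.level n).pert_mul_s
  rw [← LinearMap.comp_assoc, ← Module.End.mul_eq_comp, k, Module.End.mul_eq_comp,
    LinearMap.comp_assoc, LinearMap.comp_assoc, LinearMap.comp_add, LinearMap.add_comp, H.tdiff_g]
  rfl

/-- The mirror image of `pert_g`: `pert_mul_s` in the opposite ring, with `t_s_eq` used to recognise
the same transferred perturbation `ftsg`. -/
theorem pert_f (n : ℕ) :
    (tdiff B n + f n ∘ₗ (t n ∘ₗ s n) ∘ₗ g n) ∘ₗ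
        (f n ∘ₗ (1 + t n * s n * h n : Module.End R (TPow A.toGrMod n))) =
      (f n ∘ₗ (1 + t n * s n * h n : Module.End R (TPow A.toGrMod n))) ∘ₗ (tdiff A n + t n) := by
  have k := (H.level n).op.pert_mul_s
  simp only [← MulOpposite.op_mul, ← MulOpposite.op_add, MulOpposite.op_inj] at k
  have k' : (1 + t n * s n * h n : Module.End R (TPow A.toGrMod n)) ∘ₗ (tdiff A n + t n) =
      (tdiff A n + (t n ∘ₗ s n) ∘ₗ g n ∘ₗ f n) ∘ₗ (1 + t n * s n * h n) := by
    rw [← mul_assoc, H.t_s_eq] at k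
    exact k
  have e : (tdiff B n + f n ∘ₗ (t n ∘ₗ s n) ∘ₗ g n) ∘ₗ f n =
      f n ∘ₗ (tdiff A n + (t n ∘ₗ s n) ∘ₗ g n ∘ₗ f n) := by
    rw [LinearMap.add_comp, LinearMap.comp_add, H.tdiff_f]
    rfl
  rw [LinearMap.comp_assoc (tdiff A n + t n), k', ← LinearMap.comp_assoc, e, LinearMap.comp_assoc]

theorem pert_h (n : ℕ) :
    (tdiff A n + t n) ∘ₗ (s n ∘ₗ h n) + (s n ∘ₗ h n) ∘ₗ (tdiff A n + t n) =
      (s n ∘ₗ g n) ∘ₗ (f n ∘ₗ (1 + t n * s n * h n : Module.End R (TPow A.toGrMod n))) -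
        LinearMap.id :=
  (H.level n).pert_homotopy

theorem pert_f_g (n : ℕ) :
    (f n ∘ₗ (1 + t n * s n * h n : Module.End R (TPow A.toGrMod n))) ∘ₗ s n ∘ₗ g n =
      LinearMap.id := by
  have k : (1 + t n * s n * h n : Module.End R (TPow A.toGrMod n)) ∘ₗ s n ∘ₗ g n =
      s n ∘ₗ g n := by
    rw [← LinearMap.comp_assoc, ← Module.End.mul_eq_comp, add_mul, one_mul, mul_assoc,
      (H.level n).h_s, LinearMap.add_comp, Module.End.mul_eq_comp (t n * s n),
      LinearMap.comp_assoc, H.h_g, LinearMap.comp_zero, add_zero]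
  rw [LinearMap.comp_assoc, k, ← LinearMap.comp_assoc, H.f_comp_s, H.f_g]

theorem pert_f_h (n : ℕ) :
    (f n ∘ₗ (1 + t n * s n * h n : Module.End R (TPow A.toGrMod n))) ∘ₗ s n ∘ₗ h n = 0 := by
  have k : (1 + t n * s n * h n : Module.End R (TPow A.toGrMod n)) * (s n * h n) =
      s n * h n := by
    rw [add_mul, one_mul, mul_assoc, ← mul_assoc (h n), (H.level n).h_s, (H.level n).h_h,
      mul_zero, add_zero]
  rw [LinearMap.comp_assoc, ← Module.End.mul_eq_comp (s n), ← Module.End.mul_eq_comp (1 + _), k,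
    Module.End.mul_eq_comp, ← LinearMap.comp_assoc, H.f_comp_s, H.f_h]

theorem pert_h_h (n : ℕ) : (s n ∘ₗ h n) ∘ₗ s n ∘ₗ h n = 0 := by
  change s n * h n * (s n * h n) = 0
  rw [mul_assoc, ← mul_assoc (h n), (H.level n).h_s, (H.level n).h_h, mul_zero]

theorem pert_h_g (n : ℕ) : (s n ∘ₗ h n) ∘ₗ s n ∘ₗ g n = 0 := by
  have k : h n ∘ₗ s n = h n := (H.level n).h_s
  rw [LinearMap.comp_assoc, ← LinearMap.comp_assoc _ _ (h n), k, H.h_g, LinearMap.comp_zero]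

theorem isThick_f_pert : IsThick 0 (f + f.comp ((t.comp s).comp h)) :=
  H.contraction.deg_f.add
    (H.contraction.deg_f.comp ((H.pert.deg.comp H.deg_s (i := -1)).comp H.contraction.deg_h (i := 0)))

theorem isThick_s_g : IsThick 0 (s.comp g) := H.deg_s.comp H.contraction.deg_g

theorem isThick_s_h : IsThick 1 (s.comp h) := H.deg_s.comp H.contraction.deg_h

theorem isThick_t_pert : IsThick (-1) (f.comp ((t.comp s).comp g)) :=
  H.contraction.deg_f.comp ((H.pert.deg.comp H.deg_s (i := -1)).comp H.contraction.deg_g (i := -1))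

/-- The transferred perturbation, together with the differential, squares to zero. -/
theorem t_pert_sq (n : ℕ) (hd : tdiff A n ∘ₗ tdiff A n = 0) :
    (tdiff B n + f n ∘ₗ (t n ∘ₗ s n) ∘ₗ g n) ∘ₗ (tdiff B n + f n ∘ₗ (t n ∘ₗ s n) ∘ₗ g n) = 0 := by
  have h0 : (tdiff A n + t n) ∘ₗ (tdiff A n + t n) = 0 := by
    have k := (H.level n).pert
    rw [LinearMap.add_comp, LinearMap.comp_add, LinearMap.comp_add, hd, zero_add, ← add_assoc]
    exact k
  have k : (s n ∘ₗ g n) ∘ₗ ((tdiff B n + f n ∘ₗ (t n ∘ₗ s n) ∘ₗ g n) ∘ₗ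
      (tdiff B n + f n ∘ₗ (t n ∘ₗ s n) ∘ₗ g n)) = 0 := by
    rw [← LinearMap.comp_assoc, ← H.pert_g, LinearMap.comp_assoc, ← H.pert_g,
      ← LinearMap.comp_assoc, h0, LinearMap.zero_comp]
  -- `g' = sg` has the left inverse `f'`, so the vanishing of `g'(d + t')²` suffices.
  rw [← LinearMap.id_comp ((tdiff B n + _) ∘ₗ _), ← H.pert_f_g n, LinearMap.comp_assoc, k,
    LinearMap.comp_zero]

/-! ### Compatibility with tensor products -/

end ThickPert

/-! ### The operators on `A^{⊗ p} ⊗ A^{⊗ q}` -/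

section TensorOperators

variable {M N : Type*} [AddCommGroup M] [Module R M] [AddCommGroup N] [Module R N]

/-- `x ⊗ 1`, as a ring homomorphism in `x`. -/
def leftHom (R M N : Type*) [CommRing R] [AddCommGroup M] [Module R M] [AddCommGroup N]
    [Module R N] : Module.End R M →+* Module.End R (M ⊗[R] N) where
  toFun x := TensorProduct.map x LinearMap.id
  map_one' := TensorProduct.map_id
  map_mul' x y := by
    rw [Module.End.mul_eq_comp, Module.End.mul_eq_comp, ← TensorProduct.map_comp,
      LinearMap.id_comp]
  map_zero' := TensorProduct.map_zero_left _
  map_add' x y := TensorProduct.map_add_left _ _ _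

/-- `1 ⊗ y`, without a sign, as a ring homomorphism in `y`. -/
def rightHom (R M N : Type*) [CommRing R] [AddCommGroup M] [Module R M] [AddCommGroup N]
    [Module R N] : Module.End R N →+* Module.End R (M ⊗[R] N) where
  toFun y := TensorProduct.map LinearMap.id y
  map_one' := TensorProduct.map_id
  map_mul' x y := by
    rw [Module.End.mul_eq_comp, Module.End.mul_eq_comp, ← TensorProduct.map_comp,
      LinearMap.id_comp]
  map_zero' := TensorProduct.map_zero_right _
  map_add' x y := TensorProduct.map_add_right _ _ _

theorem leftHom_mul_rightHom (x : Module.End R M) (y : Module.End R N) :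
    leftHom R M N x * rightHom R M N y = TensorProduct.map x y := by
  change TensorProduct.map x LinearMap.id ∘ₗ TensorProduct.map LinearMap.id y = _
  rw [← TensorProduct.map_comp, LinearMap.id_comp, LinearMap.comp_id]

theorem leftHom_comm_rightHom (x : Module.End R M) (y : Module.End R N) :
    leftHom R M N x * rightHom R M N y = rightHom R M N y * leftHom R M N x := by
  rw [leftHom_mul_rightHom]
  change _ = TensorProduct.map LinearMap.id y ∘ₗ TensorProduct.map x LinearMap.id
  rw [← TensorProduct.map_comp, LinearMap.id_comp, LinearMap.comp_id]

/-- The Koszul relations between `x ⊗ 1` and `1 ⊗ y`, where `τ` is the sign operator. -/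
theorem koszulPair_leftHom_rightHom {τ d₁ t₁ h₁ s₁ p₁ : Module.End R M}
    {d₂ t₂ h₂ s₂ p₂ : Module.End R N}
    (hd : d₁ * τ = -(τ * d₁)) (ht : t₁ * τ = -(τ * t₁)) (hh : h₁ * τ = -(τ * h₁))
    (hs : s₁ * τ = τ * s₁) (hp : p₁ * τ = τ * p₁) :
    KoszulPair (leftHom R M N d₁) (leftHom R M N t₁) (leftHom R M N h₁) (leftHom R M N s₁)
      (leftHom R M N p₁) (leftHom R M N τ * rightHom R M N d₂)
      (leftHom R M N τ * rightHom R M N t₂) (leftHom R M N τ * rightHom R M N h₂)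
      (rightHom R M N s₂) (rightHom R M N p₂) := by
  have odd : ∀ (x : Module.End R M) (y : Module.End R N), x * τ = -(τ * x) →
      leftHom R M N x * (leftHom R M N τ * rightHom R M N y) =
        -(leftHom R M N τ * rightHom R M N y * leftHom R M N x) := fun x y hx => by
    rw [mul_assoc, ← leftHom_comm_rightHom, ← mul_assoc, ← mul_assoc, ← map_mul, hx, map_neg,
      map_mul]
    exact LinearMap.neg_comp _ _
  have even : ∀ (x : Module.End R M) (y : Module.End R N), x * τ = τ * x →
      leftHom R M N x * (leftHom R M N τ * rightHom R M N y) =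
        leftHom R M N τ * rightHom R M N y * leftHom R M N x := fun x y hx => by
    rw [mul_assoc, ← leftHom_comm_rightHom, ← mul_assoc, ← mul_assoc, ← map_mul, hx, map_mul]
  have comm := leftHom_comm_rightHom (R := R) (M := M) (N := N)
  constructor <;>
  simp only [Set.mem_insert_iff, Set.mem_singleton_iff, forall_eq_or_imp, forall_eq]
  · exact ⟨⟨odd _ _ hd, odd _ _ hd, odd _ _ hd⟩, ⟨odd _ _ ht, odd _ _ ht, odd _ _ ht⟩,
      ⟨odd _ _ hh, odd _ _ hh, odd _ _ hh⟩⟩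
  · exact ⟨⟨even _ _ hs, even _ _ hs, even _ _ hs, comm _ _, comm _ _⟩,
      ⟨even _ _ hp, even _ _ hp, even _ _ hp, comm _ _, comm _ _⟩⟩
  · exact ⟨⟨comm _ _, comm _ _⟩, ⟨comm _ _, comm _ _⟩, ⟨comm _ _, comm _ _⟩⟩

end TensorOperators

theorem IsThick.odd_tsgn {A : GrMod.{u, v} R} {k : ℤ} {f : ThickFam A A} (hf : IsThick k f)
    (hk : sg R k = -1) (n : ℕ) :
    (f n * tsgn A 1 n : Module.End R (TPow A n)) = -(tsgn A 1 n * f n) := by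
  have := hf.comp_tsgn 1 n
  rw [one_mul, hk, neg_one_smul_linearMap] at this
  exact this

theorem IsThick.even_tsgn {A : GrMod.{u, v} R} {f : ThickFam A A} (hf : IsThick 0 f) (n : ℕ) :
    (f n * tsgn A 1 n : Module.End R (TPow A n)) = tsgn A 1 n * f n := by
  have := hf.comp_tsgn 1 n
  rw [mul_zero, sg_zero, one_smul] at this
  exact this

/-- Since conjugation is a ring isomorphism, all identities at level `p + q` transfer to `A^{⊗ p} ⊗
A^{⊗ q}`. -/
theorem mstar_eq_conj {A : GrMod.{u, v} R} (F : ThickFam A A) (p q : ℕ) :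
    mstar F p q = (TensorPower.mulEquiv (R := R) (M := A) (n := p) (m := q)).symm.conjRingEquiv
      (F (p + q)) := rfl

theorem mstar_comp {A : GrMod.{u, v} R} (F G : ThickFam A A) (p q : ℕ) :
    mstar (F.comp G) p q =
      (mstar F p q * mstar G p q : Module.End R (TPow A p ⊗[R] TPow A q)) := by
  rw [mstar_eq_conj, mstar_eq_conj, mstar_eq_conj, ← map_mul]
  rfl

theorem comp_mulEquiv_eq {A : GrMod.{u, v} R} (F : ThickFam A A) (p q : ℕ) :
    F (p + q) ∘ₗ (TensorPower.mulEquiv (R := R) (M := A) (n := p) (m := q)).toLinearMap =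
      (TensorPower.mulEquiv (R := R) (M := A) (n := p) (m := q)).toLinearMap ∘ₗ mstar F p q := by
  ext1
  ext
  simp [mstar]

theorem mstar_eq_of_comp_mulEquiv {A : GrMod.{u, v} R} {F : ThickFam A A} {p q : ℕ}
    {X : Module.End R (TPow A p ⊗[R] TPow A q)}
    (h : F (p + q) ∘ₗ (TensorPower.mulEquiv (R := R) (M := A) (n := p) (m := q)).toLinearMap =
      (TensorPower.mulEquiv (R := R) (M := A) (n := p) (m := q)).toLinearMap ∘ₗ X) :
    mstar F p q = X := by
  rw [comp_mulEquiv_eq] at h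
  refine LinearMap.ext fun x => ?_
  exact (TensorPower.mulEquiv (R := R) (M := A) (n := p) (m := q)).injective
    (LinearMap.congr_fun h x)

theorem mstar_derivExt {A : GrMod.{u, v} R} (k : ℤ) (t : A →ₗ[R] A) (hk : tsgn A k = tsgn A 1)
    (p q : ℕ) : mstar (derivExt A k t) p q = leftHom R _ _ (derivExt A k t p) +
      leftHom R _ _ (tsgn A 1 p) * rightHom R _ _ (derivExt A k t q) := by
  rw [leftHom_mul_rightHom, ← hk]
  exact mstar_eq_of_comp_mulEquiv (derivExt_comp_mulEquiv k t p q)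

theorem tsgn_neg_one (A : GrMod.{u, v} R) : tsgn A (-1) = tsgn A 1 :=
  funext fun n => tsgn_neg A 1 n

theorem mstar_derivation {A : GrMod.{u, v} R} {t : ThickFam A A} (ht : IsDerivation (-1) t)
    (p q : ℕ) : mstar t p q = leftHom R _ _ (t p) +
      leftHom R _ _ (tsgn A 1 p) * rightHom R _ _ (t q) := by
  have : t = derivExt A (-1) t.level1 := funext ht
  rw [this]
  exact mstar_derivExt _ _ (tsgn_neg_one A) p q

theorem mstar_morphism {A : GrMod.{u, v} R} {B : GrMod.{u, w} R} {f : ThickFam A B}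
    {g : ThickFam B A} (hf : IsMorphism f) (hg : IsMorphism g) (p q : ℕ) :
    mstar (g.comp f) p q = leftHom R _ _ (g p ∘ₗ f p) * rightHom R _ _ (g q ∘ₗ f q) := by
  rw [leftHom_mul_rightHom]
  refine mstar_eq_of_comp_mulEquiv ?_
  rw [ThickFam.comp, LinearMap.comp_assoc, hf.comp_mulEquiv, ← LinearMap.comp_assoc,
    hg.comp_mulEquiv, LinearMap.comp_assoc, TensorProduct.map_comp]

theorem ktensor_one {A : GrMod.{u, v} R} {p q : ℕ} (x : Module.End R (TPow A p))
    (y : Module.End R (TPow A q)) : ktensor 1 x y =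
      leftHom R _ _ x * (leftHom R _ _ (tsgn A 1 p) * rightHom R _ _ y) := by
  rw [← mul_assoc, ← map_mul, leftHom_mul_rightHom]
  rfl

theorem ktensor_zero_id {A : GrMod.{u, v} R} {p q : ℕ} (x : Module.End R (TPow A p)) :
    ktensor 0 x (LinearMap.id : TPow A q →ₗ[R] TPow A q) = leftHom R _ _ x := by
  rw [ktensor, tsgn_zero]
  rfl

theorem ktensor_one_id {A : GrMod.{u, v} R} {p q : ℕ} (y : Module.End R (TPow A q)) :
    ktensor 1 (LinearMap.id : TPow A p →ₗ[R] TPow A p) y =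
      leftHom R _ _ (tsgn A 1 p) * rightHom R _ _ y := by
  rw [ktensor_one, show leftHom R (TPow A p) (TPow A q) LinearMap.id = 1 from map_one _, one_mul]

/-! ### Multiplicativity of the perturbed maps. -/

namespace ThickPert

variable {A : ChainCx.{u, v} R} {B : ChainCx.{u, w} R}
  {f : ThickFam A.toGrMod B.toGrMod} {g : ThickFam B.toGrMod A.toGrMod}
  {h t s : ThickFam A.toGrMod A.toGrMod} (H : ThickPert A B f g h t s)
  (hf : IsMorphism f) (hg : IsMorphism g) (hh : IsPseudoDerivation h)
  (ht : IsDerivation (-1) t)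
include H hf hg hh ht

/-- The bridge to the ring lemmas: the derivation and morphism hypotheses make the total `d`, `t`
sums and the projection a product, while `h` and `s` are just the transported maps of level `p + q`.
-/
theorem pseudoTensor (p q : ℕ) :
    PseudoTensor (E := Module.End R (TPow A.toGrMod p ⊗[R] TPow A.toGrMod q))
      (leftHom R _ _ (tdiff A p)) (leftHom R _ _ (t p)) (leftHom R _ _ (h p))
      (leftHom R _ _ (s p)) (leftHom R _ _ (g p ∘ₗ f p))
      (leftHom R _ _ (tsgn A.toGrMod 1 p) * rightHom R _ _ (tdiff A q))
      (leftHom R _ _ (tsgn A.toGrMod 1 p) * rightHom R _ _ (t q))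
      (leftHom R _ _ (tsgn A.toGrMod 1 p) * rightHom R _ _ (h q))
      (rightHom R _ _ (s q)) (rightHom R _ _ (g q ∘ₗ f q)) (mstar h p q) (mstar s p q) where
  fst := (H.level p).map _
  snd := by
    -- With the Koszul sign, an odd operator on the second factor is `τ ⊗ y` with `τ` the sign
    -- operator on the first; `τ² = 1` lets the twist preserve all relations.
    refine (PertHomotopy.map (F := Module.End R (TPow A.toGrMod p ⊗[R] TPow A.toGrMod q))
      (rightHom R (TPow A.toGrMod p) (TPow A.toGrMod q)) (H.level q)).twist ?_ ?_ ?_ ?_ ?_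
    · rw [← map_mul, ← map_one (leftHom R (TPow A.toGrMod p) (TPow A.toGrMod q))]
      exact congrArg _ (tsgn_mul_self A.toGrMod 1 p)
    all_goals rw [leftHom_comm_rightHom]
  tot := by
    have hd := mstar_derivExt (-1) A.d (tsgn_neg_one A.toGrMod) p q
    rw [← mstar_morphism hf hg, ← mstar_derivation ht, tdiff, tdiff, ← hd]
    exact PertHomotopy.map (F := Module.End R (TPow A.toGrMod p ⊗[R] TPow A.toGrMod q))
      (TensorPower.mulEquiv (R := R) (M := A) (n := p) (m := q)).symm.conjRingEquiv.toRingHom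
      (H.level (p + q))
  pair := by
    refine koszulPair_leftHom_rightHom ?_ ?_ ?_ ?_ ?_
    · exact (isThick_derivExt A.d_mem).odd_tsgn (by rw [sg_neg, sg_one]) p
    · exact H.pert.deg.odd_tsgn (by rw [sg_neg, sg_one]) p
    · exact H.contraction.deg_h.odd_tsgn sg_one p
    · exact H.deg_s.even_tsgn p
    · exact (H.contraction.deg_g.comp H.contraction.deg_f).even_tsgn p
  pseudo := by
    have := (hh p q).1
    rw [ktensor_zero_id, ktensor_one_id, ktensor_one] at this
    exact this
  pseudo' := by
    have := (hh p q).2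
    rw [ktensor_zero_id, ktensor_one_id, ktensor_one] at this
    exact this

theorem isPseudoDerivation_s_h : IsPseudoDerivation (s.comp h) := by
  intro p q
  have T := H.pseudoTensor hf hg hh ht p q
  have c := T.pair.even_left _ (Set.mem_insert _ _)
    (leftHom R _ _ (tsgn A.toGrMod 1 p) * rightHom R _ _ (h q)) (by simp)
  have hs : (s p * tsgn A.toGrMod 1 p : Module.End R (TPow A.toGrMod p)) = _ := H.deg_s.even_tsgn p
  have e1 : leftHom R (TPow A.toGrMod p) (TPow A.toGrMod q) (s.comp h p) =
      leftHom R _ _ (s p) * leftHom R _ _ (h p) := map_mul (leftHom R _ _) _ _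
  have e2 : leftHom R _ _ (tsgn A.toGrMod 1 p) * rightHom R _ _ (s.comp h q) =
      rightHom R _ _ (s q) * (leftHom R _ _ (tsgn A.toGrMod 1 p) * rightHom R _ _ (h q)) := by
    rw [← mul_assoc, ← leftHom_comm_rightHom, mul_assoc, ← map_mul]
    rfl
  rw [ktensor_zero_id, ktensor_one_id, ktensor_one, mstar_comp, e1, e2]
  exact ⟨T.pseudo_pert, T.pseudo_pert'⟩

/-- Compose `s_mul_p` with `g ⊗ g`; the projection `(g ⊗ g)(f ⊗ f)` disappears because `fg = 1`. -/
theorem isMorphism_s_g : IsMorphism (s.comp g) := by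
  have z : s 0 = LinearMap.id := by
    have := (H.level 0).s_eq
    rw [H.contraction.deg_h.apply_zero one_ne_zero, zero_mul, zero_mul, add_zero] at this
    exact this
  refine isMorphism_of_comp_mulEquiv ?_ fun n => ?_
  · have h0 : s.comp g 0 = g 0 := by rw [ThickFam.comp, z, LinearMap.id_comp]
    rw [h0, hg 0]
    congr 1
    exact funext fun i => i.elim0
  · have T := (H.pseudoTensor hf hg hh ht n 1).s_mul_p
    have hP : leftHom R (TPow A.toGrMod n) (TPow A.toGrMod 1) (g n ∘ₗ f n) *
        rightHom R (TPow A.toGrMod n) (TPow A.toGrMod 1) (g 1 ∘ₗ f 1) =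
        TensorProduct.map (g n) (g 1) ∘ₗ TensorProduct.map (f n) (f 1) := by
      rw [leftHom_mul_rightHom, TensorProduct.map_comp]
    have hFG : TensorProduct.map (f n) (f 1) ∘ₗ TensorProduct.map (g n) (g 1) = LinearMap.id := by
      rw [← TensorProduct.map_comp, H.f_g, H.f_g, TensorProduct.map_id]
    rw [hP, leftHom_mul_rightHom] at T
    have T' := congrArg (fun X => X ∘ₗ TensorProduct.map (g n) (g 1)) T
    simp only [Module.End.mul_eq_comp, LinearMap.comp_assoc, hFG, LinearMap.comp_id] at T'
    rw [ThickFam.comp, LinearMap.comp_assoc, hg.comp_mulEquiv, ← LinearMap.comp_assoc,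
      comp_mulEquiv_eq, LinearMap.comp_assoc, T', ← TensorProduct.map_comp]
    rfl

theorem isMorphism_f_pert : IsMorphism (f + f.comp ((t.comp s).comp h)) := by
  refine isMorphism_of_comp_mulEquiv ?_ fun n => ?_
  · have h0 : (f + f.comp ((t.comp s).comp h)) 0 = f 0 := by
      rw [Pi.add_apply, ThickFam.comp, ThickFam.comp,
        H.contraction.deg_h.apply_zero one_ne_zero, LinearMap.comp_zero, LinearMap.comp_zero,
        add_zero]
    rw [h0, hf 0]
    congr 1
    exact funext fun i => i.elim0
  · have P := H.pseudoTensor hf hg hh ht n 1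
    have T := P.p_mul_s
    have hP : leftHom R (TPow A.toGrMod n) (TPow A.toGrMod 1) (g n ∘ₗ f n) *
        rightHom R (TPow A.toGrMod n) (TPow A.toGrMod 1) (g 1 ∘ₗ f 1) =
        TensorProduct.map (g n) (g 1) ∘ₗ TensorProduct.map (f n) (f 1) := by
      rw [leftHom_mul_rightHom, TensorProduct.map_comp]
    have hFG : TensorProduct.map (f n) (f 1) ∘ₗ TensorProduct.map (g n) (g 1) = LinearMap.id := by
      rw [← TensorProduct.map_comp, H.f_g, H.f_g, TensorProduct.map_id]
    -- `s' = (1 - th)⁻¹`, so `f' = fs'`. It has degree `0`, and in `e3` the two sign operators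
    -- coming from `t` and `h` cancel.
    let s' : ThickFam A.toGrMod A.toGrMod := fun m => (1 + t m * s m * h m : Module.End R _)
    have e1 : (1 + (leftHom R _ _ (t n) + leftHom R _ _ (tsgn A.toGrMod 1 n) *
        rightHom R _ _ (t 1)) * mstar s n 1 * mstar h n 1 :
          Module.End R (TPow A.toGrMod n ⊗[R] TPow A.toGrMod 1)) = mstar s' n 1 := by
      rw [← mstar_derivation ht]
      simp only [mstar_eq_conj, ← map_mul]
      rw [← map_one (TensorPower.mulEquiv (R := R) (M := A) (n := n) (m := 1)).symm.conjRingEquiv,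
        ← map_add]
    have e2 : (1 + leftHom R _ _ (t n) * leftHom R _ _ (s n) * leftHom R _ _ (h n) :
        Module.End R (TPow A.toGrMod n ⊗[R] TPow A.toGrMod 1)) = leftHom R _ _ (s' n) := by
      rw [← map_mul, ← map_mul, ← map_one (leftHom R _ _), ← map_add]
    have e3 : (1 + leftHom R _ _ (tsgn A.toGrMod 1 n) * rightHom R _ _ (t 1) *
        rightHom R _ _ (s 1) * (leftHom R _ _ (tsgn A.toGrMod 1 n) * rightHom R _ _ (h 1)) :
        Module.End R (TPow A.toGrMod n ⊗[R] TPow A.toGrMod 1)) = rightHom R _ _ (s' 1) := by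
      have ττ : (leftHom R _ _ (tsgn A.toGrMod 1 n) * leftHom R _ _ (tsgn A.toGrMod 1 n) :
          Module.End R (TPow A.toGrMod n ⊗[R] TPow A.toGrMod 1)) = 1 := by
        rw [← map_mul, ← map_one (leftHom R _ _)]
        exact congrArg _ (tsgn_mul_self A.toGrMod 1 n)
      rw [mul_assoc (leftHom R _ _ _), ← map_mul, mul_assoc (leftHom R _ _ _), ← mul_assoc
        (rightHom R _ _ _), ← leftHom_comm_rightHom, mul_assoc (leftHom R _ _ _), ← map_mul,
        ← mul_assoc, ττ, one_mul, ← map_one (rightHom R _ _), ← map_add]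
    rw [e1, e2, e3, hP, leftHom_mul_rightHom] at T
    have T' := congrArg (fun X => TensorProduct.map (f n) (f 1) ∘ₗ X) T
    simp only [Module.End.mul_eq_comp, ← LinearMap.comp_assoc, hFG, LinearMap.id_comp] at T'
    rw [f_pert_eq, f_pert_eq, f_pert_eq]
    change (f (n + 1) ∘ₗ s' (n + 1)) ∘ₗ _ =
      _ ∘ₗ TensorProduct.map (f n ∘ₗ s' n) (f 1 ∘ₗ s' 1)
    rw [LinearMap.comp_assoc, comp_mulEquiv_eq, ← LinearMap.comp_assoc, hf.comp_mulEquiv,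
      LinearMap.comp_assoc, T', ← TensorProduct.map_comp]

theorem isDerivation_t_pert : IsDerivation (-1) (f.comp ((t.comp s).comp g)) := by
  refine isDerivation_of_comp_mulEquiv (H.isThick_t_pert.apply_zero (by norm_num)) fun n => ?_
  have T := (H.pseudoTensor hf hg hh ht n 1).p_t_s_p
  have hP : leftHom R (TPow A.toGrMod n) (TPow A.toGrMod 1) (g n ∘ₗ f n) *
      rightHom R (TPow A.toGrMod n) (TPow A.toGrMod 1) (g 1 ∘ₗ f 1) =
      TensorProduct.map (g n) (g 1) ∘ₗ TensorProduct.map (f n) (f 1) := by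
    rw [leftHom_mul_rightHom, TensorProduct.map_comp]
  have hFG : TensorProduct.map (f n) (f 1) ∘ₗ TensorProduct.map (g n) (g 1) = LinearMap.id := by
    rw [← TensorProduct.map_comp, H.f_g, H.f_g, TensorProduct.map_id]
  have e : leftHom R _ _ (t n) * leftHom R _ _ (s n) + leftHom R _ _ (tsgn A.toGrMod 1 n) *
      rightHom R _ _ (t 1) * rightHom R _ _ (s 1) =
      TensorProduct.map (t n ∘ₗ s n) (LinearMap.id : TPow A.toGrMod 1 →ₗ[R] TPow A.toGrMod 1) +
        TensorProduct.map (tsgn A.toGrMod 1 n) (t 1 ∘ₗ s 1) := by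
    rw [mul_assoc (leftHom R _ _ _), ← map_mul, ← map_mul, leftHom_mul_rightHom]
    rfl
  rw [← mstar_derivation ht, ← mstar_comp, e, hP] at T
  -- Compressing by `f ⊗ f` and `g ⊗ g` absorbs the outer projections, leaving the Leibniz formula
  -- for `ftsg`.
  have T' := congrArg (fun X => TensorProduct.map (f n) (f 1) ∘ₗ X ∘ₗ
    TensorProduct.map (g n) (g 1)) T
  simp only [Module.End.mul_eq_comp, LinearMap.comp_assoc, hFG, LinearMap.comp_id] at T'
  simp only [← LinearMap.comp_assoc, hFG, LinearMap.id_comp] at T'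
  have hτ : f n ∘ₗ tsgn A.toGrMod 1 n = tsgn B.toGrMod 1 n ∘ₗ f n := by
    have := H.contraction.deg_f.comp_tsgn 1 n
    rwa [mul_zero, sg_zero, one_smul] at this
  have E : TensorProduct.map (f n) (f 1) ∘ₗ mstar (t.comp s) n 1 ∘ₗ
      TensorProduct.map (g n) (g 1) =
      TensorProduct.map (f.comp ((t.comp s).comp g) n) LinearMap.id +
        TensorProduct.map (tsgn B.toGrMod (-1) n) (f.comp ((t.comp s).comp g) 1) := by
    rw [← LinearMap.comp_assoc, T', LinearMap.comp_add, LinearMap.add_comp,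
      ← TensorProduct.map_comp, ← TensorProduct.map_comp, ← TensorProduct.map_comp,
      ← TensorProduct.map_comp, LinearMap.comp_id, H.f_g, hτ, LinearMap.comp_assoc (g n) (f n), H.f_g,
      LinearMap.comp_id, tsgn_neg]
    rfl
  rw [← E]
  change (f (n + 1) ∘ₗ (t.comp s (n + 1)) ∘ₗ g (n + 1)) ∘ₗ _ = _
  rw [LinearMap.comp_assoc, LinearMap.comp_assoc, hg.comp_mulEquiv, ← LinearMap.comp_assoc
    (TensorProduct.map _ _), comp_mulEquiv_eq, LinearMap.comp_assoc, ← LinearMap.comp_assoc,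
    hf.comp_mulEquiv, LinearMap.comp_assoc]

end ThickPert

end

section

variable {R : Type u} [CommRing R]

/-! ## Perturbed tensor differentials -/

theorem level1_tdiff (A : ChainCx.{u, v} R) : ThickFam.level1 (tdiff A) = A.d := by
  ext x
  exact ThickFam.level1_eq (derivExt_one_tprod _ _ _)

theorem tdiff_one_comp_tdiff_one (A : ChainCx.{u, v} R) : tdiff A 1 ∘ₗ tdiff A 1 = 0 := by
  refine tpow_one_ext fun x => ?_
  rw [LinearMap.comp_apply, tdiff, derivExt_one_tprod, derivExt_one_tprod, A.d_d]
  exact MultilinearMap.map_coord_zero _ 0 rfl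

/-- As `d² = 0`, the equation `(d + t)² = 0` is the perturbation equation; it is moved along `A^{⊗
1} ≃ A`. -/
theorem isPerturbation_level1 {A : ChainCx.{u, v} R} {t : ThickFam A.toGrMod A.toGrMod}
    (hdeg : IsThick (-1) t) (h : (tdiff A 1 + t 1) ∘ₗ (tdiff A 1 + t 1) = 0) :
    IsPerturbation A t.level1 where
  deg i x hx := hdeg.level1 i x hx
  eq := by
    have h1 : (ThickFam.comp (tdiff A + t) (tdiff A + t)).level1 = 0 := by
      ext x
      rw [ThickFam.level1_apply]
      change PiTensorProduct.subsingletonEquiv _ (((tdiff A 1 + t 1) ∘ₗ (tdiff A 1 + t 1)) _) = _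
      rw [h, LinearMap.zero_apply, map_zero, LinearMap.zero_apply]
    have hd : A.d ∘ₗ A.d = 0 := LinearMap.ext A.d_d
    rw [ThickFam.level1_comp, ThickFam.level1_add, level1_tdiff, LinearMap.add_comp,
      LinearMap.comp_add, LinearMap.comp_add, hd, zero_add, ← add_assoc] at h1
    exact h1

/-- This is where being a derivation is essential: perturbing `A` by `t_1` alone perturbs each `A^{⊗
n}` by exactly `t_n`. -/
theorem tdiff_perturb {A : ChainCx.{u, v} R} {t : ThickFam A.toGrMod A.toGrMod}
    (ht : IsDerivation (-1) t) (hp : IsPerturbation A t.level1) (n : ℕ) :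
    tdiff (A.perturb t.level1 hp) n = tdiff A n + t n := by
  rw [ht n]
  exact derivExt_add _ _ _ _

/-! ## Functoriality of the Schur functor -/

section Schur

variable {O : SymSeq.{u, s} R} {A : GrMod.{u, v} R} {B : GrMod.{u, w} R} {C : GrMod.{u, z} R}

theorem schur_hom_ext {M : Type*} [AddCommMonoid M] [Module R M] {φ ψ : Schur O A →ₗ[R] M}
    (h : ∀ (n : ℕ) (μ : O.obj n) (x : TPow A n),
      φ (schurMk O A n (μ ⊗ₜ[R] x)) = ψ (schurMk O A n (μ ⊗ₜ[R] x))) : φ = ψ := by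
  have e : ∀ n, φ ∘ₗ schurMk O A n = ψ ∘ₗ schurMk O A n := fun n =>
    TensorProduct.ext' fun μ x => h n μ x
  refine DirectSum.linearMap_ext R fun n => LinearMap.ext fun x => ?_
  obtain ⟨y, rfl⟩ := Submodule.mkQ_surjective _ x
  exact LinearMap.congr_fun (e n) y

theorem schurMap_schurMk {k : ℤ} {f : ThickFam A B} (hf : IsSymmetric f) {n : ℕ} (μ : O.obj n)
    (x : TPow A n) : schurMap O k f hf (schurMk O A n (μ ⊗ₜ[R] x)) =
      schurMk O B n ((O.obj n).sgn k μ ⊗ₜ[R] f n x) := by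
  simp only [schurMap, schurMk, LinearMap.comp_apply, DirectSum.lmap_lof, Submodule.mkQ_apply,
    Submodule.mapQ_apply, TensorProduct.map_tmul]

theorem schurMap_comp {k l : ℤ} {g : ThickFam B C} {f : ThickFam A B} (hg : IsSymmetric g)
    (hf : IsSymmetric f) (hgf : IsSymmetric (g.comp f)) :
    schurMap O l g hg ∘ₗ schurMap O k f hf = schurMap O (k + l) (g.comp f) hgf := by
  apply schur_hom_ext
  intro n μ x
  rw [LinearMap.comp_apply, schurMap_schurMk, schurMap_schurMk, schurMap_schurMk, add_comm k,
    ← GrMod.sgn_comp_sgn]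
  rfl

theorem schurMap_add {k : ℤ} {f f' : ThickFam A B} (hf : IsSymmetric f) (hf' : IsSymmetric f')
    (hff' : IsSymmetric (f + f')) :
    schurMap O k (f + f') hff' = schurMap O k f hf + schurMap O k f' hf' := by
  apply schur_hom_ext
  intro n μ x
  rw [LinearMap.add_apply, schurMap_schurMk, schurMap_schurMk, schurMap_schurMk, Pi.add_apply,
    LinearMap.add_apply, TensorProduct.tmul_add, map_add]

theorem schurMap_id (h : IsSymmetric (ThickFam.id A)) :
    schurMap O 0 (ThickFam.id A) h = LinearMap.id := by
  apply schur_hom_ext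
  intro n μ x
  rw [schurMap_schurMk, GrMod.sgn_zero]
  rfl

theorem IsSymmetric.id : IsSymmetric (ThickFam.id A) := fun _ _ => rfl

theorem IsSymmetric.comp {g : ThickFam B C} {f : ThickFam A B} (hg : IsSymmetric g)
    (hf : IsSymmetric f) : IsSymmetric (g.comp f) := fun n σ => by
  rw [ThickFam.comp, LinearMap.comp_assoc, hf, ← LinearMap.comp_assoc, hg, LinearMap.comp_assoc]

theorem IsSymmetric.add {f f' : ThickFam A B} (hf : IsSymmetric f) (hf' : IsSymmetric f') :
    IsSymmetric (f + f') := fun n σ => by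
  rw [Pi.add_apply, LinearMap.add_comp, hf, hf', LinearMap.comp_add]

/-- The inverse of a symmetric thick map is symmetric. -/
theorem IsSymmetric.of_inverse {f : ThickFam A B} {g : ThickFam B A} (hf : IsSymmetric f)
    (hgf : g.comp f = ThickFam.id A) (hfg : f.comp g = ThickFam.id B) : IsSymmetric g := fun n σ => by
  have h1 : g n ∘ₗ f n = LinearMap.id := congrFun hgf n
  have h2 : f n ∘ₗ g n = LinearMap.id := congrFun hfg n
  calc g n ∘ₗ permTensor B σ = g n ∘ₗ permTensor B σ ∘ₗ f n ∘ₗ g n := by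
        rw [h2, LinearMap.comp_id]
    _ = g n ∘ₗ (f n ∘ₗ permTensor A σ) ∘ₗ g n := by rw [hf]; rfl
    _ = (g n ∘ₗ f n) ∘ₗ permTensor A σ ∘ₗ g n := rfl
    _ = permTensor A σ ∘ₗ g n := by rw [h1, LinearMap.id_comp]

namespace IsAlgThickMap

variable {γA : Schur O A →ₗ[R] A} {γB : Schur O B →ₗ[R] B} {γC : Schur O C →ₗ[R] C} {k l : ℤ}

theorem comp {g : ThickFam B C} {f : ThickFam A B} (hg : IsAlgThickMap O γB γC l g)
    (hf : IsAlgThickMap O γA γB k f) {i : ℤ} (hi : k + l = i := by norm_num) :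
    IsAlgThickMap O γA γC i (g.comp f) where
  deg := hg.deg.comp hf.deg hi
  symmetric := hg.symmetric.comp hf.symmetric
  comm := by
    subst hi
    rw [← schurMap_comp hg.symmetric hf.symmetric, ← LinearMap.comp_assoc, hg.comm,
      LinearMap.comp_assoc, hf.comm, ThickFam.level1_comp, LinearMap.comp_assoc]

theorem add {f f' : ThickFam A B} (hf : IsAlgThickMap O γA γB k f)
    (hf' : IsAlgThickMap O γA γB k f') : IsAlgThickMap O γA γB k (f + f') where
  deg := hf.deg.add hf'.deg
  symmetric := hf.symmetric.add hf'.symmetric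
  comm := by
    rw [schurMap_add hf.symmetric hf'.symmetric, LinearMap.comp_add, hf.comm, hf'.comm,
      ThickFam.level1_add, LinearMap.add_comp]

/-- The inverse of `1 - n` is a thick map of `O`-algebras if `n` is. -/
theorem one_sub_inverse {n s : ThickFam A A} (hn : IsAlgThickMap O γA γA 0 n) (hs : IsThick 0 s)
    (hl : s.comp (ThickFam.id A - n) = ThickFam.id A)
    (hr : (ThickFam.id A - n).comp s = ThickFam.id A) : IsAlgThickMap O γA γA 0 s := by
  have hsymm : IsSymmetric s := by
    refine IsSymmetric.of_inverse (f := ThickFam.id A - n) (fun m σ => ?_) hl hr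
    rw [Pi.sub_apply, LinearMap.sub_comp, LinearMap.comp_sub, hn.symmetric]
    rfl
  have h1 : s = ThickFam.id A + n.comp s := by
    funext m
    have : (LinearMap.id - n m) ∘ₗ s m = LinearMap.id := congrFun hr m
    rw [LinearMap.sub_comp, LinearMap.id_comp, sub_eq_iff_eq_add] at this
    exact this
  have h2 : s = ThickFam.id A + s.comp n := by
    funext m
    have : s m ∘ₗ (LinearMap.id - n m) = LinearMap.id := congrFun hl m
    rw [LinearMap.comp_sub, LinearMap.comp_id, sub_eq_iff_eq_add] at this
    exact this
  have e1 : schurMap O 0 s hsymm =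
      LinearMap.id + schurMap O 0 n hn.symmetric ∘ₗ schurMap O 0 s hsymm := by
    rw [schurMap_comp hn.symmetric hsymm (hn.symmetric.comp hsymm), ← schurMap_id IsSymmetric.id]
    have := schurMap_add (O := O) (k := 0) IsSymmetric.id (hn.symmetric.comp hsymm)
      (IsSymmetric.id.add (hn.symmetric.comp hsymm))
    simp only [← h1] at this
    exact this
  -- In other words `(1 - n_1) γ O[s] = γ`, because `γ O[n] = n_1 γ`. Applying `s_1`, a left inverse
  -- of `1 - n_1`, gives the claim; `e4` and `e5` carry this out with a common summand to cancel.
  have e2 : γA ∘ₗ schurMap O 0 s hsymm =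
      γA + n.level1 ∘ₗ γA ∘ₗ schurMap O 0 s hsymm := by
    conv_lhs => rw [e1]
    rw [LinearMap.comp_add, LinearMap.comp_id, ← LinearMap.comp_assoc, hn.comm,
      LinearMap.comp_assoc]
  have e3 : s.level1 = LinearMap.id + s.level1 ∘ₗ n.level1 := by
    conv_lhs => rw [h2]
    rw [ThickFam.level1_add, ThickFam.level1_id, ThickFam.level1_comp]
  refine ⟨hs, hsymm, ?_⟩
  have e4 := congrArg (fun X => s.level1 ∘ₗ X) e2
  simp only [LinearMap.comp_add, ← LinearMap.comp_assoc] at e4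
  have e5 : (s.level1 ∘ₗ γA) ∘ₗ schurMap O 0 s hsymm = γA ∘ₗ schurMap O 0 s hsymm +
      ((s.level1 ∘ₗ n.level1) ∘ₗ γA) ∘ₗ schurMap O 0 s hsymm := by
    conv_lhs => rw [e3]
    rw [LinearMap.add_comp, LinearMap.add_comp, LinearMap.id_comp]
  rw [e5] at e4
  exact add_right_cancel e4

end IsAlgThickMap

end Schur

/-! ### The perturbed algebras and the perturbed thick contraction. -/

/-- An algebra structure survives a perturbation by a derivation of algebras. -/
theorem IsAlgebra.perturb {O : Operad.{u, s} R} {A : ChainCx.{u, v} R}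
    {γ : Schur O.toSymSeq A.toGrMod →ₗ[R] A} (hγ : IsAlgebra O A γ)
    {t : ThickFam A.toGrMod A.toGrMod} (ht : IsDerivation (-1) t)
    (ht' : IsAlgThickMap O.toSymSeq γ γ (-1) t) (hp : IsPerturbation A t.level1) :
    IsAlgebra O (A.perturb t.level1 hp) γ where
  deg := hγ.deg
  chain := by
    -- The differential of `O[A]` changes by `O[t]`, with the same sign `(-1) ^ |μ|`. The chain map
    -- condition is then the old one plus `γ O[t] = t_1 γ`; degree, unit and associativity do not
    -- involve the differential.
    have h1 : schurDiff O.toSymSeq (A.perturb t.level1 hp) =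
        schurDiff O.toSymSeq A + schurMap O.toSymSeq (-1) t ht'.symmetric := by
      apply schur_hom_ext
      intro n μ x
      rw [LinearMap.add_apply, schurMap_schurMk]
      simp only [schurDiff, schurMk, LinearMap.comp_apply, DirectSum.lmap_lof,
        Submodule.mkQ_apply, LinearMap.add_apply, Submodule.mapQ_apply, TensorProduct.map_tmul,
        tdiff_perturb ht, TensorProduct.tmul_add, map_add, Submodule.Quotient.mk_add, add_assoc]
    change (A.d + t.level1) ∘ₗ γ = γ ∘ₗ _
    rw [h1, LinearMap.comp_add, LinearMap.add_comp, ht'.comm, hγ.chain]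
  unit := hγ.unit
  assoc := hγ.assoc

namespace ThickPert

variable {A : ChainCx.{u, v} R} {B : ChainCx.{u, w} R}
  {f : ThickFam A.toGrMod B.toGrMod} {g : ThickFam B.toGrMod A.toGrMod}
  {h t s : ThickFam A.toGrMod A.toGrMod} (H : ThickPert A B f g h t s)
include H

theorem isPerturbation_t : IsPerturbation A t.level1 := by
  refine isPerturbation_level1 H.pert.deg ?_
  rw [LinearMap.add_comp, LinearMap.comp_add, LinearMap.comp_add, tdiff_one_comp_tdiff_one,
    zero_add, ← add_assoc]
  exact (H.level 1).pert

theorem isPerturbation_t_pert : IsPerturbation B (f.comp ((t.comp s).comp g)).level1 :=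
  isPerturbation_level1 H.isThick_t_pert (H.t_pert_sq 1 (tdiff_one_comp_tdiff_one A))

/-- The perturbation lemma for thick contractions. -/
theorem isThickContraction (ht : IsDerivation (-1) t)
    (ht' : IsDerivation (-1) (f.comp ((t.comp s).comp g)))
    (hA : IsPerturbation A t.level1) (hB : IsPerturbation B (f.comp ((t.comp s).comp g)).level1) :
    IsThickContraction (A.perturb _ hA) (B.perturb _ hB) (f + f.comp ((t.comp s).comp h))
      (s.comp g) (s.comp h) where
  deg_f := H.isThick_f_pert
  deg_g := H.isThick_s_g
  deg_h := H.isThick_s_h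
  bdry_f := by
    funext n
    rw [ThickFam.bdry, sg_zero, one_smul, tdiff_perturb ht, tdiff_perturb ht', f_pert_eq]
    exact sub_eq_zero.mpr (H.pert_f n)
  bdry_g := by
    funext n
    rw [ThickFam.bdry, sg_zero, one_smul, tdiff_perturb ht, tdiff_perturb ht']
    exact sub_eq_zero.mpr (H.pert_g n)
  bdry_h := by
    funext n
    rw [ThickFam.bdry, sg_one, neg_one_smul_linearMap, sub_neg_eq_add, tdiff_perturb ht]
    refine (H.pert_h n).trans ?_
    rw [← f_pert_eq]
    rfl
  f_g := by
    funext n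
    rw [ThickFam.comp, f_pert_eq]
    exact H.pert_f_g n
  f_h := by
    funext n
    rw [ThickFam.comp, f_pert_eq]
    exact H.pert_f_h n
  h_h := funext H.pert_h_h
  h_g := funext H.pert_h_g

end ThickPert

end

end ThickHPT

end

/-! ### The perturbation lemma for thick contractions of algebras. -/

theorem mainTheorem10 {R : Type*} [CommRing R] (O : ThickHPT.Operad R)
    (A : ThickHPT.ChainCx R) (γA : ThickHPT.Schur O.toSymSeq A.toGrMod →ₗ[R] A)
    (B : ThickHPT.ChainCx R) (γB : ThickHPT.Schur O.toSymSeq B.toGrMod →ₗ[R] B)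
    (f : ThickHPT.ThickFam A.toGrMod B.toGrMod) (g : ThickHPT.ThickFam B.toGrMod A.toGrMod)
    (h : ThickHPT.ThickFam A.toGrMod A.toGrMod)
    (hD : ThickHPT.IsAlgThickContraction O A γA B γB f g h)
    (t : ThickHPT.ThickFam A.toGrMod A.toGrMod)
    (ht : ThickHPT.IsThickPerturbation A t)
    (ht_der : ThickHPT.IsDerivation (-1) t)
    (ht_alg : ThickHPT.IsAlgThickMap O.toSymSeq γA γA (-1) t)
    -- `s` is the inverse of `1 - ht`
    (s : ThickHPT.ThickFam A.toGrMod A.toGrMod) (hs_deg : ThickHPT.IsThick 0 s)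
    (hs_left : s.comp (ThickHPT.ThickFam.id A.toGrMod - h.comp t) = ThickHPT.ThickFam.id A.toGrMod)
    (hs_right : (ThickHPT.ThickFam.id A.toGrMod - h.comp t).comp s = ThickHPT.ThickFam.id A.toGrMod)
    (S : ThickHPT.ThickFam A.toGrMod A.toGrMod) (hS : S = t.comp s)
    (f' : ThickHPT.ThickFam A.toGrMod B.toGrMod) (hf' : f' = f + f.comp (S.comp h))
    (g' : ThickHPT.ThickFam B.toGrMod A.toGrMod) (hg' : g' = g + h.comp (S.comp g))
    (h' : ThickHPT.ThickFam A.toGrMod A.toGrMod) (hh' : h' = h + h.comp (S.comp h))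
    (t' : ThickHPT.ThickFam B.toGrMod B.toGrMod) (ht' : t' = f.comp (S.comp g)) :
    ∃ (hA : ThickHPT.IsPerturbation A t.level1) (hB : ThickHPT.IsPerturbation B t'.level1),
      ThickHPT.IsAlgThickContraction O (A.perturb t.level1 hA) γA (B.perturb t'.level1 hB) γB
        f' g' h' := by
  subst hS
  have H : ThickHPT.ThickPert A B f g h t s := ⟨hD.contraction, ht, hs_deg, hs_left, hs_right⟩
  rw [H.g_pert_eq] at hg'
  rw [H.h_pert_eq] at hh'
  subst hf' hg' hh' ht'
  have hder := H.isDerivation_t_pert hD.morphism_f hD.morphism_g hD.pseudo_h ht_der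
  -- Here `n = ht`, of degree `0`. Once `s` is a thick map of algebras, so are `f'`, `g'`, `h'` and
  -- `t'`, being built from `f`, `g`, `h`, `t`, `s` by sums and composites.
  have hs_alg := (hD.alg_h.comp ht_alg).one_sub_inverse hs_deg hs_left hs_right
  have hS_alg := ht_alg.comp hs_alg (i := -1)
  have hA := H.isPerturbation_t
  have hB := H.isPerturbation_t_pert
  exact ⟨hA, hB,
    { contraction := H.isThickContraction ht_der hder hA hB
      algebra_A := hD.algebra_A.perturb ht_der ht_alg hA
      algebra_B := hD.algebra_B.perturb hder
        (hD.alg_f.comp (hS_alg.comp hD.alg_g (i := -1))) hB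
      morphism_f := H.isMorphism_f_pert hD.morphism_f hD.morphism_g hD.pseudo_h ht_der
      morphism_g := H.isMorphism_s_g hD.morphism_f hD.morphism_g hD.pseudo_h ht_der
      pseudo_h := H.isPseudoDerivation_s_h hD.morphism_f hD.morphism_g hD.pseudo_h ht_der
      alg_f := hD.alg_f.add (hD.alg_f.comp (hS_alg.comp hD.alg_h (i := 0)))
      alg_g := hs_alg.comp hD.alg_g
      alg_h := hs_alg.comp hD.alg_h }⟩
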